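/- Let $\mathbf k$ be a field, let $n\ge 0$, let $a_0,\dots,a_n$ be positive integers, and let $\theta=(\theta_{ij})_{0\le i,j\le n}$ be a matrix with entries $\theta_{ij}\in\mathbf k^*$. Let $S_\theta=S_\theta(a_0,\dots,a_n)$ be the graded $\mathbf k$-algebra generated by elements $x_0,\dots,x_n$, with $\deg x_i=a_i$, subject to the relations $\theta_{ij}x_ix_j=\theta_{ji}x_jx_i$ for all $i,j$. Write $l=\sum_{i=0}^n a_i$, and let $\mathbf k$ be the $S_\theta$-module on which every $x_i$ acts by $0$, placed in degree $0$. Then $S_\theta$ is a (left and right) noetherian Artin–Schelter regular algebra of global dimension $n+1$ with Gorenstein parameter $l$. Explicitly: (0) $S_\theta$ is left and right noetherian, and it is connected: $(S_\theta)_p=0$ for $p<0$ and $(S_\theta)_0=\mathbf k$. (1) $S_\theta$ has right and left global dimension $n+1$: for right modules, and also for left modules, $n+1$ is the least $d\ge 0$ such that $\operatorname{Ext}^{d+1}_{S_\theta}(M,N)=0$ for all modules $M,N$. (2) $S_\theta$ has polynomial growth: there are $c,\delta\in\mathbb R$ with $\dim_{\mathbf k}(S_\theta)_p\le c\,p^{\delta}$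 for all integers $p\ge1$ (in particular these dimensions are finite). (3) For $\operatorname{Ext}$ of right modules, $\operatorname{Ext}^i_{S_\theta}(\mathbf k,S_\theta)=0$ for $i\ne n+1$, and $\operatorname{Ext}^{n+1}_{S_\theta}(\mathbf k,S_\theta)\cong\mathbf k(l)$ as graded left $S_\theta$-modules, where $\mathbf k(l)_j=\mathbf k_{j+l}$. (A class in $\operatorname{Ext}^i_{S_\theta}(\mathbf k,S_\theta)$ is homogeneous of degree $j$ if it is represented by a cocycle $P_i\to S_\theta$ that is homogeneous of degree $j$, for a graded projective resolution $P_\bullet$ of $\mathbf k$.) Moreover, the following Koszul complex is a resolution of the right module $\mathbf k$ by graded free right modules, with maps homogeneous of degree $0$: $$0\to K_{n+1}\to\cdots\to K_1\to K_0\to\mathbf k\to0,\qquad K_m=\bigoplus_{I\subseteq\{0,\dots,n\},\ |I|=m}S_\theta\Bigl(-\sum_{i\in I}a_i\Bigr),$$ where $K_0=S_\theta\to\mathbf k$ sends every $x_i$ to $0$, and the differential sends the generator $e_I$ of the summand indexed by $I=\{i_0<\dots<i_{m-1}\}$ to $$\sum_{s=0}^{m-1}(-1)^s\Bigl(\prod_{j\in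 I}\theta_{j i_s}\Bigr)e_{I\setminus\{i_s\}}\,x_{i_s}.$$ -/

import Mathlib

open CategoryTheory CategoryTheory.Abelian DirectSum

universe u

/-! ### Graded algebras, regularity -/

section Regular

variable {k A : Type u} [Field k] [Ring A] [Algebra k A]

/-- The right `A`-module `A`. Right `A`-modules are modules over `Aᵐᵒᵖ`. -/
abbrev rightRegular (A : Type u) [Ring A] : ModuleCat.{u} Aᵐᵒᵖ := ModuleCat.of Aᵐᵒᵖ A

/-- The field `k` as a right `A`-module through an augmentation `ε : A → k`, so that
`c · a = c * ε a`. -/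
noncomputable def trivialRight (ε : A →ₐ[k] k) : ModuleCat.{u} Aᵐᵒᵖ :=
  (ModuleCat.restrictScalars
    (ε.fromOpposite fun x y => Commute.all (ε x) (ε y)).toRingHom).obj (ModuleCat.of k k)

/-- Left multiplication by `a`, as an endomorphism of the right `A`-module `A`. -/
def leftMulRight (a : A) : A →ₗ[Aᵐᵒᵖ] A where
  toFun x := a * x
  map_add' := mul_add a
  map_smul' b x := (mul_assoc a x b.unop).symm

/-- The left `A`-module structure of `Ext^i_A(M, A)`, for a right module `M`: the element `a`
acts through the endomorphism `x ↦ a * x` of the second argument. -/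
noncomputable def extLeftAct {M : ModuleCat.{u} Aᵐᵒᵖ} {i : ℕ} (a : A)
    (e : Ext M (rightRegular A) i) : Ext M (rightRegular A) i :=
  e.comp (Ext.mk₀ (ModuleCat.ofHom (leftMulRight a))) (add_zero i)

/-- `deg` makes the right `A`-module `M` into a `ℤ`-graded module over the algebra `A` with
grading `𝒜`: `M = ⨁ p, deg p` and `deg p * 𝒜 q ⊆ deg (p + q)`. -/
structure IsRightGrading (𝒜 : ℤ → Submodule k A) {M : Type u} [AddCommGroup M]
    [Module Aᵐᵒᵖ M] (deg : ℤ → AddSubgroup M) : Prop where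
  isInternal : DirectSum.IsInternal deg
  smul_mem : ∀ (p q : ℤ) (m : M) (a : A), m ∈ deg p → a ∈ 𝒜 q →
    MulOpposite.op a • m ∈ deg (p + q)

/-- A graded projective resolution of the right module `k`, where `k` is in degree `0`: a
projective resolution whose terms are graded modules, with differentials and augmentation
homogeneous of degree `0`. -/
structure GradedProjectiveResolution (𝒜 : ℤ → Submodule k A) (ε : A →ₐ[k] k) where
  res : ProjectiveResolution (trivialRight ε)
  deg : ∀ i : ℕ, ℤ → AddSubgroup (res.complex.X i)
  isRightGrading : ∀ i, IsRightGrading 𝒜 (deg i)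
  d_mem : ∀ (i : ℕ) (p : ℤ) (x : res.complex.X (i + 1)), x ∈ deg (i + 1) p →
    (res.complex.d (i + 1) i).hom x ∈ deg i p
  π_eq_zero : ∀ (p : ℤ) (x : res.complex.X 0), p ≠ 0 → x ∈ deg 0 p →
    (res.π.f 0).hom x = 0

/-- The internal grading of `Ext^i_A(k, A)`: a class is homogeneous of degree `j` if it is the
class of a cocycle `f : P_i → A` with `f ((P_i)_p) ⊆ A_{p + j}` for all `p`, that is, of a
homomorphism of graded modules `P_i → A(j)`, where `P` is a graded projective resolution
of `k`. -/
def IsHomogeneousExt (𝒜 : ℤ → Submodule k A) (ε : A →ₐ[k] k) {i : ℕ}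
    (e : Ext (trivialRight ε) (rightRegular A) i) (j : ℤ) : Prop :=
  ∃ (P : GradedProjectiveResolution 𝒜 ε) (f : P.res.complex.X i ⟶ rightRegular A)
    (hf : P.res.complex.d (i + 1) i ≫ f = 0),
    (∀ (p : ℤ) (x : P.res.complex.X i), x ∈ P.deg i p → (f.hom x : A) ∈ 𝒜 (p + j)) ∧
      P.res.extMk f (i + 1) rfl hf = e

/-- The category of all left `R`-modules has global dimension `d`: `d` is the least natural
number such that `Ext^{d+1}(M, N) = 0` for all `M` and `N`. For right modules one takes
`Rᵐᵒᵖ` in place of `R`. -/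
def HasGlobalDimension (R : Type u) [Ring R] (d : ℕ) : Prop :=
  IsLeast {e : ℕ | ∀ M N : ModuleCat.{u} R, Subsingleton (Ext M N (e + 1))} d

/-- The graded algebra `A = ⨁ 𝒜 p` is connected with augmentation `ε : A → k`: it is
concentrated in degrees `≥ 0`, `𝒜 0 = k`, and `ε` kills the elements of nonzero degree. -/
structure IsConnectedGraded (𝒜 : ℤ → Submodule k A) (ε : A →ₐ[k] k) : Prop where
  eq_bot : ∀ p : ℤ, p < 0 → 𝒜 p = ⊥
  zero_eq : 𝒜 0 = 1
  aug_eq_zero : ∀ (p : ℤ) (x : A), p ≠ 0 → x ∈ 𝒜 p → ε x = 0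

/-- `A` is Gorenstein with parameter `l`, in dimension `d`: `Ext^i_A(k, A) = 0` for `i ≠ d`, and
`Ext^d_A(k, A)` is isomorphic, as a graded left `A`-module, to `k(l)`, where
`k(l)_j = k_{j + l}` is `k` for `j + l = 0` and is `0` otherwise. -/
structure IsGorenstein (𝒜 : ℤ → Submodule k A) (ε : A →ₐ[k] k) (d : ℕ) (l : ℤ) : Prop where
  ext_eq_zero : ∀ i : ℕ, i ≠ d → Subsingleton (Ext (trivialRight ε) (rightRegular A) i)
  ext_equiv : ∃ φ : Ext (trivialRight ε) (rightRegular A) d ≃+ k,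
    (∀ (a : A) e, φ (extLeftAct a e) = ε a * φ e) ∧
    ∀ (j : ℤ) e, IsHomogeneousExt 𝒜 ε e j ↔ (j + l = 0 ∨ φ e = 0)

/-- The connected graded algebra `A` is (Artin–Schelter) regular of dimension `d`, with
Gorenstein parameter `l`. -/
structure IsASRegular (𝒜 : ℤ → Submodule k A) [GradedAlgebra 𝒜] (ε : A →ₐ[k] k)
    (d : ℕ) (l : ℤ) : Prop where
  connected : IsConnectedGraded 𝒜 ε
  right_globalDimension : HasGlobalDimension Aᵐᵒᵖ d
  left_globalDimension : HasGlobalDimension A d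
  polynomial_growth : ∃ c δ : ℝ, ∀ p : ℕ, 0 < p →
    Module.Finite k (𝒜 p) ∧ (Module.finrank k (𝒜 p) : ℝ) ≤ c * (p : ℝ) ^ δ
  gorenstein : IsGorenstein 𝒜 ε d l

end Regular

/-! ### The algebra `S_θ` -/

section STheta

variable {k : Type u} [Field k] {n : ℕ}

/-- The relations `θ_ij x_i x_j = θ_ji x_j x_i` in the free algebra on `x_0, …, x_n`. -/
inductive SThetaRel (θ : Matrix (Fin (n + 1)) (Fin (n + 1)) kˣ) :
    FreeAlgebra k (Fin (n + 1)) → FreeAlgebra k (Fin (n + 1)) → Prop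
  | comm (i j : Fin (n + 1)) : SThetaRel θ
      ((θ i j : k) • (FreeAlgebra.ι k i * FreeAlgebra.ι k j))
      ((θ j i : k) • (FreeAlgebra.ι k j * FreeAlgebra.ι k i))

/-- The algebra `S_θ`. -/
abbrev STheta (θ : Matrix (Fin (n + 1)) (Fin (n + 1)) kˣ) : Type u := RingQuot (SThetaRel θ)

namespace STheta

variable (a : Fin (n + 1) → ℕ) (θ : Matrix (Fin (n + 1)) (Fin (n + 1)) kˣ)

/-- The generators `x_i`. -/
noncomputable def x (i : Fin (n + 1)) : STheta θ :=
  RingQuot.mkAlgHom k (SThetaRel θ) (FreeAlgebra.ι k i)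

theorem x_comm (i j : Fin (n + 1)) :
    (θ i j : k) • (x θ i * x θ j) = (θ j i : k) • (x θ j * x θ i) := by
  have h := RingQuot.mkAlgHom_rel k (SThetaRel.comm (θ := θ) i j)
  simpa [x] using h

/-- The homomorphism out of `S_θ` given by elements that satisfy the relations. -/
noncomputable def lift {B : Type*} [Semiring B] [Algebra k B] (y : Fin (n + 1) → B)
    (h : ∀ i j, (θ i j : k) • (y i * y j) = (θ j i : k) • (y j * y i)) : STheta θ →ₐ[k] B :=
  RingQuot.liftAlgHom k ⟨FreeAlgebra.lift k y, by
    rintro _ _ ⟨i, j⟩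
    simpa using h i j⟩

theorem lift_x {B : Type*} [Semiring B] [Algebra k B] (y : Fin (n + 1) → B)
    (h : ∀ i j, (θ i j : k) • (y i * y j) = (θ j i : k) • (y j * y i)) (i : Fin (n + 1)) :
    lift θ y h (x θ i) = y i := by
  simp [lift, x]

theorem algHom_ext {B : Type*} [Semiring B] [Algebra k B] {f g : STheta θ →ₐ[k] B}
    (h : ∀ i, f (x θ i) = g (x θ i)) : f = g := by
  apply RingQuot.ringQuot_ext'
  apply FreeAlgebra.hom_ext
  funext i
  exact h i

/-- The augmentation `S_θ → k`, `x_i ↦ 0`. -/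
noncomputable def aug : STheta θ →ₐ[k] k := lift θ (fun _ => 0) (by simp)

/-- The homogeneous elements of degree `p`, where `x_i` has degree `a i`: the span of the words
`x_{i_1} ⋯ x_{i_r}` with `a_{i_1} + ⋯ + a_{i_r} = p`. -/
noncomputable def grading (p : ℤ) : Submodule k (STheta θ) :=
  Submodule.span k {y | ∃ w : List (Fin (n + 1)),
    (w.map fun i => (a i : ℤ)).sum = p ∧ (w.map (x θ)).prod = y}

theorem x_mem (i : Fin (n + 1)) : x θ i ∈ grading a θ (a i) :=
  Submodule.subset_span ⟨[i], by simp, by simp⟩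

instance gradedMonoid : SetLike.GradedMonoid (grading a θ) where
  one_mem := Submodule.subset_span ⟨[], by simp, by simp⟩
  mul_mem := by
    intro p q y z hy hz
    have h : grading a θ p * grading a θ q ≤ grading a θ (p + q) := by
      unfold grading
      rw [Submodule.span_mul_span]
      apply Submodule.span_mono
      rintro _ ⟨_, ⟨v, hv, rfl⟩, _, ⟨w, hw, rfl⟩, rfl⟩
      exact ⟨v ++ w, by simp [hv, hw], by simp⟩
    exact h (Submodule.mul_mem_mul hy hz)

/-- The map `S_θ → ⨁ p, S_p` that sends `x_i` to `x_i` in degree `a_i`. -/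
noncomputable def toDirectSum : STheta θ →ₐ[k] ⨁ p : ℤ, grading a θ p :=
  lift θ (fun i => DirectSum.of (fun p => grading a θ p) (a i) ⟨x θ i, x_mem a θ i⟩) (by
    intro i j
    rw [DirectSum.of_mul_of, DirectSum.of_mul_of, ← DirectSum.lof_eq_of k,
      ← DirectSum.lof_eq_of k, ← map_smul, ← map_smul, DirectSum.lof_eq_of,
      DirectSum.lof_eq_of]
    apply DirectSum.of_eq_of_gradedMonoid_eq
    refine Sigma.subtype_ext (add_comm _ _) ?_
    exact x_comm θ i j)

theorem toDirectSum_word (w : List (Fin (n + 1)))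
    (h : (w.map (x θ)).prod ∈ grading a θ (w.map fun i => (a i : ℤ)).sum) :
    toDirectSum a θ (w.map (x θ)).prod =
      DirectSum.of (fun p => grading a θ p) (w.map fun i => (a i : ℤ)).sum
        ⟨(w.map (x θ)).prod, h⟩ := by
  induction w with
  | nil => exact map_one _
  | cons i w ih =>
    have hw : (w.map (x θ)).prod ∈ grading a θ (w.map fun i => (a i : ℤ)).sum :=
      Submodule.subset_span ⟨w, rfl, rfl⟩
    simp only [List.map_cons, List.prod_cons, map_mul]
    rw [ih hw]
    rw [toDirectSum, lift_x, DirectSum.of_mul_of]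
    apply DirectSum.of_eq_of_gradedMonoid_eq
    exact Sigma.subtype_ext List.sum_cons.symm rfl

/-- `S_θ` is a graded algebra. -/
noncomputable instance gradedAlgebra : GradedAlgebra (grading a θ) :=
  GradedAlgebra.ofAlgHom (grading a θ) (toDirectSum a θ)
    (by
      apply algHom_ext
      intro i
      simp [toDirectSum, lift_x])
    (by
      rintro p ⟨y, hy⟩
      change toDirectSum a θ y = DirectSum.of (fun p => grading a θ p) p ⟨y, hy⟩
      induction hy using Submodule.span_induction with
      | mem y h =>
        obtain ⟨w, rfl, rfl⟩ := h
        exact toDirectSum_word a θ w _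
      | zero =>
        rw [map_zero]
        exact (map_zero (DirectSum.of (fun p => grading a θ p) p)).symm
      | add y z hy hz ihy ihz =>
        rw [map_add, ihy, ihz, ← map_add]
        rfl
      | smul c y hy ih =>
        rw [map_smul, ih, ← DirectSum.lof_eq_of k, ← DirectSum.lof_eq_of k, ← map_smul]
        rfl)

/-! ### The Koszul complex -/

/-- The `m`-element subsets of the index set `{0, …, n}`. -/
abbrev Subsets (n m : ℕ) : Type := {I : Finset (Fin (n + 1)) // I.card = m}

/-- The subset `I \ {i}`, for `i ∈ I`. -/
def Subsets.erase {m : ℕ} (I : Subsets n (m + 1)) (i : I.1) : Subsets n m :=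
  ⟨I.1.erase i.1, by rw [Finset.card_erase_of_mem i.2, I.2, Nat.add_sub_cancel]⟩

/-- The `m`-th term of the Koszul complex: the free right module on generators `e_I`, one for
each `m`-element subset `I`. It is zero for `m > n + 1`. -/
abbrev Koszul (m : ℕ) : Type u := Subsets n m → STheta θ

/-- The Koszul differential, the homomorphism of right modules with
`e_I ↦ ∑_{i ∈ I} (-1)^s (∏_{j ∈ I} θ_{j i}) e_{I \ {i}} x_i`, where `i` is preceded by exactly `s`
elements of `I`. -/
noncomputable def koszulD (m : ℕ) : Koszul θ (m + 1) →ₗ[(STheta θ)ᵐᵒᵖ] Koszul θ m :=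
  ∑ I : Subsets n (m + 1), ∑ i : I.1,
    LinearMap.single (STheta θ)ᵐᵒᵖ (fun _ : Subsets n m => STheta θ) (I.erase i) ∘ₗ
      leftMulRight (((-1 : k) ^ (I.1.filter (· < i.1)).card * ∏ j ∈ I.1, (θ j i.1 : k)) •
        x θ i.1) ∘ₗ
      LinearMap.proj (R := (STheta θ)ᵐᵒᵖ) (φ := fun _ : Subsets n (m + 1) => STheta θ) I

/-- The augmentation of the Koszul complex, with `e_∅ ↦ 1`. -/
noncomputable def koszulAug : Koszul θ 0 →ₗ[(STheta θ)ᵐᵒᵖ] trivialRight (aug θ) where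
  toFun f := aug θ (f ⟨∅, rfl⟩)
  map_add' _ _ := map_add (aug θ) _ _
  map_smul' _ _ := (map_mul (aug θ) _ _).trans (mul_comm _ _)

/-- The elements of degree `p` of the Koszul term `⨁_I S_θ(-∑_{i ∈ I} a_i)`; the generator `e_I`
has degree `∑_{i ∈ I} a_i`. -/
noncomputable def koszulGrading (m : ℕ) (p : ℤ) : Submodule k (Koszul θ m) :=
  Submodule.pi Set.univ fun I => grading a θ (p - ∑ i ∈ I.1, (a i : ℤ))

/-- The Koszul complex is a resolution of the right module `k` by graded free modules:
`0 → K_{n+1} → ⋯ → K_1 → K_0 → k → 0` is exact, and its maps are homogeneous of degree `0`. -/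
structure IsKoszulResolution : Prop where
  d_mem : ∀ (m : ℕ) (p : ℤ) (f : Koszul θ (m + 1)), f ∈ koszulGrading a θ (m + 1) p →
    koszulD θ m f ∈ koszulGrading a θ m p
  aug_eq_zero : ∀ (p : ℤ) (f : Koszul θ 0), p ≠ 0 → f ∈ koszulGrading a θ 0 p →
    koszulAug θ f = 0
  injective : Function.Injective (koszulD θ n)
  exact : ∀ m : ℕ, Function.Exact (koszulD θ (m + 1)) (koszulD θ m)
  exact_aug : Function.Exact (koszulD θ 0) (koszulAug θ)
  surjective : Function.Surjective (koszulAug θ)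

end STheta

end STheta

namespace STheta

variable {k : Type u} [Field k] {n : ℕ} (θ : Matrix (Fin (n + 1)) (Fin (n + 1)) kˣ)

/-! ### The monomial basis -/

/-! Up to invertible scalars, `STheta θ` behaves like a polynomial ring. It acts on the space with
basis ℕ^{n+1}, where `x_i` shifts the exponent vector and multiplies by `stepCoeff`. This action
shows that monomials are independent, and `word_perm` shows that they span. The product of two
monomials is a unit times a monomial (`exists_mono_mul_mono`). Leading exponents and Dickson's lemma
therefore give left noetherianity, and counting exponent vectors gives polynomial growth. The
opposite algebra is S_{θᵀ} (`opEquiv`), which exchanges left and right.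

The homological statements rest on one acyclicity argument. Take functions f of a subset J of the
indices, with values in a space with coordinates β ∈ ℕ^{n+1}, and the differential (d f)(J) = ∑_{i ∉
J} ± C_{J ∪ i, i} f(J ∪ i), where C_{I, i} shifts β by e_i up to units. It preserves the multidegree
1_J + β. In a nonzero multidegree, fix an index in its support and move one unit of it from β into
J: this contracts the complex whatever the units are, provided that d² = 0 (`KoszulType.exists_eq`,
`KoszulType.d_exact`). Only J = ∅, β = 0 survives. The same holds after adding to C operators that
do not move β, by induction on |J| + |β| (`KoszulType.d_sub_exact`).

This is used three times. With left multiplication by x_i it gives the Koszul resolution of k. With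
right multiplication, and index sets replaced by complements, it describes the dual complex, whose
only cohomology is k in degree n + 1; this computes Ext(k, S_θ). With scalar multiples of y ⊗ m ↦
x_i y ⊗ m and y ⊗ m ↦ y ⊗ m x_i subtracted from each other, it resolves an arbitrary right module M
in length n + 1. Hence the global dimension is at most n + 1, and it is at least that because
Ext^{n+1}(k, S_θ) is nonzero.

For the internal degree, a comparison map from the Koszul resolution to any graded resolution is
replaced by its part of degree 0. The generator of K_{n+1} has degree l, so a cocycle of degree j
takes a value of degree j + l on it, and the augmentation kills this value unless j + l = 0. -/

@[elab_as_elim]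
theorem induction {P : STheta θ → Prop} (algebraMap : ∀ c : k, P (algebraMap k _ c))
    (x : ∀ i, P (x θ i)) (mul : ∀ s t, P s → P t → P (s * t))
    (add : ∀ s t, P s → P t → P (s + t)) (s : STheta θ) : P s := by
  obtain ⟨s, rfl⟩ := RingQuot.mkAlgHom_surjective k (SThetaRel θ) s
  induction s using FreeAlgebra.induction with
  | grade0 c => simpa using algebraMap c
  | grade1 i => exact x i
  | mul s t hs ht => simpa using mul _ _ hs ht
  | add s t hs ht => simpa using add _ _ hs ht

/-- The scalar with which `x_i` maps the basis vector `α` to the basis vector `α + e_i` in the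
monomial representation. -/
def stepCoeff (i : Fin (n + 1)) (α : Fin (n + 1) →₀ ℕ) : kˣ := ∏ j, θ j i ^ α j

theorem stepCoeff_add_single (i j : Fin (n + 1)) (α : Fin (n + 1) →₀ ℕ) :
    stepCoeff θ i (α + Finsupp.single j 1) = stepCoeff θ i α * θ j i := by
  simp only [stepCoeff, Finsupp.add_apply, pow_add, Finset.prod_mul_distrib]
  congr 1
  rw [Finset.prod_eq_single j]
  · simp
  · intro m _ hm
    simp [hm.symm]
  · simp

/-- The representation of `S_θ` on the vector space with basis the exponent vectors. -/
noncomputable def monomialRep : STheta θ →ₐ[k] Module.End k ((Fin (n + 1) →₀ ℕ) →₀ k) :=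
  lift θ (fun i => Finsupp.linearCombination k fun α =>
      Finsupp.single (α + Finsupp.single i 1) (stepCoeff θ i α : k)) (by
    intro i j
    ext α : 2
    simp only [LinearMap.smul_apply, Module.End.mul_apply, LinearMap.comp_apply,
      Finsupp.lsingle_apply, Finsupp.linearCombination_single, one_smul, Finsupp.smul_single,
      stepCoeff_add_single, smul_eq_mul, Units.val_mul]
    -- Both sides now carry the symmetric scalar θ_ij θ_ji times the step coefficients of i and j at
    -- α.
    rw [add_right_comm]
    congr 1
    ring)

theorem monomialRep_x (i : Fin (n + 1)) (α : Fin (n + 1) →₀ ℕ) (c : k) :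
    monomialRep θ (x θ i) (Finsupp.single α c) =
      Finsupp.single (α + Finsupp.single i 1) (c * stepCoeff θ i α) := by
  simp [monomialRep, lift_x]

/-- The exponent vector of a word. -/
noncomputable def exponent (w : List (Fin (n + 1))) : Fin (n + 1) →₀ ℕ :=
  Multiset.toFinsupp (w : Multiset (Fin (n + 1)))

@[simp]
theorem exponent_nil : exponent ([] : List (Fin (n + 1))) = 0 := by simp [exponent]

theorem exponent_cons (i : Fin (n + 1)) (w : List (Fin (n + 1))) :
    exponent (i :: w) = exponent w + Finsupp.single i 1 := by
  rw [exponent, ← Multiset.cons_coe, ← Multiset.singleton_add, map_add]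
  simp [exponent, add_comm]

theorem exponent_append (v w : List (Fin (n + 1))) :
    exponent (v ++ w) = exponent v + exponent w := by
  rw [exponent, ← Multiset.coe_add, map_add]
  rfl

/-- The coefficient of a word with respect to the monomial of its exponent vector. -/
def wordCoeff (θ : Matrix (Fin (n + 1)) (Fin (n + 1)) kˣ) : List (Fin (n + 1)) → kˣ
  | [] => 1
  | i :: w => (∏ j, θ j i ^ w.count j) * wordCoeff θ w

theorem wordCoeff_cons (i : Fin (n + 1)) (w : List (Fin (n + 1))) :
    wordCoeff θ (i :: w) = stepCoeff θ i (exponent w) * wordCoeff θ w := by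
  simp [wordCoeff, stepCoeff, exponent]

theorem monomialRep_word (w : List (Fin (n + 1))) :
    monomialRep θ (w.map (x θ)).prod (Finsupp.single 0 1) =
      Finsupp.single (exponent w) (wordCoeff θ w : k) := by
  induction w with
  | nil => simp [wordCoeff]
  | cons i w ih =>
    rw [List.map_cons, List.prod_cons, map_mul, Module.End.mul_apply, ih, monomialRep_x,
      exponent_cons, wordCoeff_cons, Units.val_mul, mul_comm]

/-- Reordering a word is a chain of adjacent transpositions, and for one transposition the two
coefficients differ exactly by the scalars of `x_comm`. This is the spanning half of the basis
theorem. -/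
theorem word_perm {v w : List (Fin (n + 1))} (h : v.Perm w) :
    (wordCoeff θ w : k) • (v.map (x θ)).prod = (wordCoeff θ v : k) • (w.map (x θ)).prod := by
  induction h with
  | nil => rfl
  | cons i h ih =>
    simp only [List.map_cons, List.prod_cons, wordCoeff, Units.val_mul, mul_smul,
      fun j => h.count_eq j]
    rw [← mul_smul_comm, ih, mul_smul_comm]
  | swap i j w =>
    have h := x_comm θ i j
    simp only [wordCoeff_cons, exponent_cons, stepCoeff_add_single, List.map_cons,
      List.prod_cons, ← mul_assoc, Units.val_mul]
    have e : ∀ (a b c d : k) (s : STheta θ), (a * b * c * d) • s = (a * c * d) • b • s := by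
      intro a b c d s
      rw [smul_smul]
      ring_nf
    rw [e, e, ← smul_mul_assoc (θ j i : k), ← smul_mul_assoc (θ i j : k), h]
    congr 1
    ring
  | trans h₁ h₂ ih₁ ih₂ =>
    rename_i w₁ w₂ w₃
    have : (wordCoeff θ w₂ : k) ≠ 0 := Units.ne_zero _
    apply smul_right_injective _ this
    dsimp only
    rw [smul_comm, ih₁, smul_comm, ih₂, smul_comm]

/-- The monomial with exponent vector `α`, normalized so that it maps the basis vector `0` of the
monomial representation to the basis vector `α`. -/
noncomputable def mono (α : Fin (n + 1) →₀ ℕ) : STheta θ :=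
  (↑(wordCoeff θ (Finsupp.toMultiset α).toList)⁻¹ : k) •
    ((Finsupp.toMultiset α).toList.map (x θ)).prod

theorem exponent_toList (α : Fin (n + 1) →₀ ℕ) : exponent (Finsupp.toMultiset α).toList = α := by
  simp [exponent]

theorem word_eq (w : List (Fin (n + 1))) :
    (w.map (x θ)).prod = (wordCoeff θ w : k) • mono θ (exponent w) := by
  have h : (Finsupp.toMultiset (exponent w)).toList.Perm w := by
    rw [← Multiset.coe_eq_coe]
    simp [exponent]
  rw [mono, smul_comm, word_perm θ h, smul_smul, Units.inv_mul, one_smul]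

theorem monomialRep_mono (α : Fin (n + 1) →₀ ℕ) :
    monomialRep θ (mono θ α) (Finsupp.single 0 1) = Finsupp.single α 1 := by
  rw [mono, map_smul, LinearMap.smul_apply, monomialRep_word, exponent_toList]
  simp

theorem x_eq_mono (i : Fin (n + 1)) : x θ i = mono θ (Finsupp.single i 1) := by
  simpa [wordCoeff, exponent_cons] using word_eq θ [i]

theorem mono_zero : mono θ 0 = 1 := by
  simpa [wordCoeff] using (word_eq θ []).symm

theorem x_mul_mono (i : Fin (n + 1)) (α : Fin (n + 1) →₀ ℕ) :
    x θ i * mono θ α = (stepCoeff θ i α : k) • mono θ (α + Finsupp.single i 1) := by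
  have h := word_eq θ (i :: (Finsupp.toMultiset α).toList)
  rw [exponent_cons, exponent_toList, wordCoeff_cons, exponent_toList, List.map_cons,
    List.prod_cons] at h
  rw [mono, mul_smul_comm, h, Units.val_mul, smul_smul, mul_left_comm, Units.inv_mul, mul_one]

theorem exists_mono_mul_mono (α β : Fin (n + 1) →₀ ℕ) :
    ∃ c : kˣ, mono θ α * mono θ β = (c : k) • mono θ (α + β) := by
  rw [mono, mono, smul_mul_smul_comm, ← List.prod_append, ← List.map_append, word_eq,
    exponent_append, exponent_toList, exponent_toList, smul_smul, ← Units.val_mul,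
    ← Units.val_mul]
  exact ⟨_, rfl⟩

/-- The monomial basis of `S_θ`. -/
noncomputable def basis : Module.Basis (Fin (n + 1) →₀ ℕ) k (STheta θ) :=
  .ofRepr (LinearEquiv.ofLinearMap ((monomialRep θ).toLinearMap.flip (Finsupp.single 0 1))
    (Finsupp.linearCombination k (mono θ))
    (by
      ext α : 2
      simpa using monomialRep_mono θ α)
    (by
      -- Under v ↦ ∑ v_α `mono θ α` the monomial representation becomes left multiplication;
      -- evaluation at the basis vector 0, which maps to 1, recovers s.
      have key : ∀ (s : STheta θ) v, Finsupp.linearCombination k (mono θ) (monomialRep θ s v) =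
          s * Finsupp.linearCombination k (mono θ) v := by
        intro s
        induction s using induction with
        | algebraMap c => intro v; simp [Algebra.smul_def, Module.algebraMap_end_apply]
        | x i =>
          intro v
          induction v using Finsupp.induction_linear with
          | zero => simp
          | add v w hv hw => simp [hv, hw, mul_add]
          | single α c =>
            rw [monomialRep_x, Finsupp.linearCombination_single,
              Finsupp.linearCombination_single, mul_smul_comm, x_mul_mono, smul_smul]
        | mul s t hs ht => intro v; rw [map_mul, Module.End.mul_apply, hs, ht, mul_assoc]
        | add s t hs ht => intro v; simp [hs, ht, add_mul]
      ext s
      have := key s (Finsupp.single 0 1)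
      simpa [mono_zero] using this))

@[simp]
theorem basis_apply (α : Fin (n + 1) →₀ ℕ) : basis θ α = mono θ α := by
  simp [basis, Module.Basis.coe_ofRepr]

end STheta

namespace STheta

variable {k : Type u} [Field k] {n : ℕ} (θ : Matrix (Fin (n + 1)) (Fin (n + 1)) kˣ)

/-! ### Noetherianity -/

/-- The coordinates of the image of a linear map that shifts the monomial basis, up to scalars. -/
theorem repr_apply_of_shift (γ : Fin (n + 1) →₀ ℕ) (T : STheta θ →ₗ[k] STheta θ)
    (c : (Fin (n + 1) →₀ ℕ) → k) (hT : ∀ α, T (mono θ α) = c α • mono θ (α + γ))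
    (s : STheta θ) (β : Fin (n + 1) →₀ ℕ) :
    (basis θ).repr (T s) β = if γ ≤ β then c (β - γ) * (basis θ).repr s (β - γ) else 0 := by
  have h : ∀ s, T s = ((basis θ).repr s).sum fun α r => r • c α • mono θ (α + γ) := by
    intro s
    conv_lhs => rw [← (basis θ).linearCombination_repr s]
    simp [Finsupp.linearCombination_apply, Finsupp.sum, hT]
  rw [h, Finsupp.sum, map_sum, Finsupp.finsetSum_apply]
  simp_rw [← basis_apply, map_smul, Module.Basis.repr_self, Finsupp.smul_apply, smul_eq_mul]
  split_ifs with hγ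
  · rw [Finset.sum_eq_single (β - γ)]
    · simp [tsub_add_cancel_of_le hγ, mul_comm]
    · intro α _ hα
      rw [Finsupp.single_eq_of_ne, mul_zero, mul_zero]
      rintro rfl
      simp at hα
    · intro h
      simp only [Finsupp.mem_support_iff, not_not] at h
      simp [h]
  · apply Finset.sum_eq_zero
    intro α _
    rw [Finsupp.single_eq_of_ne, mul_zero, mul_zero]
    rintro rfl
    simp at hγ

/-- `α` is the largest exponent vector that occurs in `s`, in the order `m`. -/
def IsLeading (m : MonomialOrder (Fin (n + 1))) (s : STheta θ) (α : Fin (n + 1) →₀ ℕ) : Prop :=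
  (basis θ).repr s α ≠ 0 ∧ ∀ β, (basis θ).repr s β ≠ 0 → m.toSyn β ≤ m.toSyn α

variable {θ} {m : MonomialOrder (Fin (n + 1))}

theorem exists_isLeading (m : MonomialOrder (Fin (n + 1))) {s : STheta θ} (hs : s ≠ 0) :
    ∃ α, IsLeading θ m s α := by
  have : ((basis θ).repr s).support.Nonempty := by
    rw [Finsupp.support_nonempty_iff]
    simpa using hs
  obtain ⟨α, hα, h⟩ := Finset.exists_max_image _ m.toSyn this
  exact ⟨α, by simpa using hα, fun β hβ => h β (by simpa using hβ)⟩

/-- Multiplication by a monomial translates the exponents and multiplies the coefficients by units,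
so nothing cancels and the order is kept. -/
theorem IsLeading.mono_mul {s : STheta θ} {α : Fin (n + 1) →₀ ℕ} (h : IsLeading θ m s α)
    (γ : Fin (n + 1) →₀ ℕ) : IsLeading θ m (mono θ γ * s) (α + γ) := by
  choose c hc using fun β => exists_mono_mul_mono θ γ β
  have key := repr_apply_of_shift θ γ (LinearMap.mulLeft k (mono θ γ)) (fun β => c β)
    (fun β => (hc β).trans (congrArg (_ • mono θ ·) (add_comm γ β))) s
  simp only [LinearMap.mulLeft_apply] at key
  constructor
  · rw [key]
    simpa using h.1
  · intro β hβ
    rw [key] at hβ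
    split_ifs at hβ with hγ
    · have := h.2 _ (right_ne_zero_of_mul hβ)
      rw [← tsub_add_cancel_of_le hγ, map_add, map_add]
      gcongr
    · exact absurd rfl hβ

/-- The leading exponent vectors of the elements of a left ideal. -/
def leadingExponents (m : MonomialOrder (Fin (n + 1))) (I : Ideal (STheta θ)) :
    Set (Fin (n + 1) →₀ ℕ) := {α | ∃ s ∈ I, IsLeading θ m s α}

theorem leadingExponents_mono {I J : Ideal (STheta θ)} (h : I ≤ J) :
    leadingExponents m I ⊆ leadingExponents m J := fun _ ⟨s, hs, hα⟩ => ⟨s, h hs, hα⟩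

theorem isUpperSet_leadingExponents (I : Ideal (STheta θ)) :
    IsUpperSet (leadingExponents m I) := by
  rintro α β hαβ ⟨s, hs, hα⟩
  refine ⟨mono θ (β - α) * s, I.mul_mem_left _ hs, ?_⟩
  simpa [add_tsub_cancel_of_le hαβ] using hα.mono_mul (β - α)

/-- Division with remainder: subtracting a scalar multiple of an element of `I` with the same
leading exponent lowers the leading exponent, and the monomial order is well-founded. -/
theorem le_of_leadingExponents_subset {I J : Ideal (STheta θ)} (hIJ : I ≤ J)
    (h : leadingExponents m J ⊆ leadingExponents m I) : J ≤ I := by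
  have key : ∀ a : m.syn, ∀ s ∈ J, ∀ α, m.toSyn α = a → IsLeading θ m s α → s ∈ I := by
    intro a
    induction a using WellFoundedLT.induction with
    | ind a ih =>
      rintro s hs α rfl hα
      obtain ⟨t, ht, hα'⟩ := h ⟨s, hs, hα⟩
      set c := (basis θ).repr s α / (basis θ).repr t α with hc
      have hst : s - c • t ∈ I := by
        by_cases h0 : s - c • t = 0
        · rw [h0]; exact I.zero_mem
        obtain ⟨β, hβ⟩ := exists_isLeading m h0
        have hJ : s - c • t ∈ J := by
          rw [Algebra.smul_def]
          exact J.sub_mem hs (J.mul_mem_left _ (hIJ ht))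
        refine ih _ (lt_of_le_of_ne ?_ ?_) _ hJ β rfl hβ
        · have := hβ.1
          rw [map_sub, map_smul, Finsupp.sub_apply, Finsupp.smul_apply] at this
          by_cases hs : (basis θ).repr s β = 0
          · refine hα'.2 _ fun ht => this ?_
            simp [hs, ht]
          · exact hα.2 _ hs
        · intro e
          obtain rfl := m.toSyn.injective e
          apply hβ.1
          simp [hc, div_mul_cancel₀ _ hα'.1]
      have : s = (s - c • t) + algebraMap k _ c * t := by rw [Algebra.smul_def]; abel
      rw [this]
      exact I.add_mem hst (I.mul_mem_left _ ht)
  intro s hs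
  by_cases h0 : s = 0
  · rw [h0]; exact I.zero_mem
  · obtain ⟨α, hα⟩ := exists_isLeading m h0
    exact key _ s hs α rfl hα

variable (θ)

/-- In a strictly increasing chain each step acquires a new leading exponent. By Dickson's lemma
some later new exponent dominates an earlier one, but then it already belonged to the upper set of
the preceding ideal. -/
theorem isNoetherianRing : IsNoetherianRing (STheta θ) := by
  rw [isNoetherianRing_iff, isNoetherian_iff']
  rw [WellFoundedGT, isWellFounded_iff, RelEmbedding.wellFounded_iff_isEmpty]
  refine ⟨fun f => ?_⟩
  have hlt : StrictMono f := fun i j h => f.map_rel_iff.2 h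
  have : ∀ i, ∃ α ∈ leadingExponents MonomialOrder.lex (f (i + 1)),
      α ∉ leadingExponents MonomialOrder.lex (f i) := by
    intro i
    by_contra! h
    exact (hlt (Nat.lt_succ_self i)).not_ge
      (le_of_leadingExponents_subset (hlt (Nat.lt_succ_self i)).le h)
  choose α hα hα' using this
  obtain ⟨i, j, hij, hle⟩ := wellQuasiOrdered_le α
  exact hα' j (isUpperSet_leadingExponents _ hle
    (leadingExponents_mono (hlt.monotone hij) (hα i)))

/-- The homomorphism `S_{θᵀ} → S_θᵒᵖ` with `x_i ↦ x_i`. -/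
noncomputable def toOpposite : STheta θ.transpose →ₐ[k] (STheta θ)ᵐᵒᵖ :=
  lift _ (fun i => MulOpposite.op (x θ i)) (by
    intro i j
    rw [← MulOpposite.op_mul, ← MulOpposite.op_mul, ← MulOpposite.op_smul,
      ← MulOpposite.op_smul]
    exact congrArg _ (x_comm θ j i))

theorem toOpposite_x (i : Fin (n + 1)) :
    toOpposite θ (x θ.transpose i) = MulOpposite.op (x θ i) := lift_x _ _ _ _

theorem opComm_toOpposite_op_x (i : Fin (n + 1)) :
    AlgHom.opComm (toOpposite θ.transpose) (MulOpposite.op (x θ i)) = x θ.transpose i :=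
  congrArg MulOpposite.unop (toOpposite_x θ.transpose i)

/-- The opposite algebra of `S_θ` is `S_{θᵀ}`. -/
noncomputable def opEquiv : STheta θ.transpose ≃ₐ[k] (STheta θ)ᵐᵒᵖ :=
  AlgEquiv.ofAlgHom (toOpposite θ) (AlgHom.opComm (toOpposite θ.transpose))
    (by
      apply AlgHom.opComm.symm.injective
      apply algHom_ext
      intro i
      exact congrArg MulOpposite.op
        ((congrArg (toOpposite θ) (opComm_toOpposite_op_x θ i)).trans (toOpposite_x θ i)))
    (by
      apply algHom_ext
      intro i
      exact (congrArg (AlgHom.opComm (toOpposite θ.transpose)) (toOpposite_x θ i)).trans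
        (opComm_toOpposite_op_x θ i))

theorem isNoetherianRing_op : IsNoetherianRing (STheta θ)ᵐᵒᵖ :=
  have := isNoetherianRing θ.transpose
  isNoetherianRing_of_ringEquiv _ (opEquiv θ).toRingEquiv

/-! ### The grading -/

variable (a : Fin (n + 1) → ℕ)

theorem grading_eq_bot {p : ℤ} (hp : p < 0) : grading a θ p = ⊥ := by
  rw [grading, Submodule.span_eq_bot]
  rintro _ ⟨w, hw, rfl⟩
  have : 0 ≤ (w.map fun i => (a i : ℤ)).sum := List.sum_nonneg (by simp)
  omega

theorem aug_eq_zero {p : ℤ} (hp : p ≠ 0) {s : STheta θ} (hs : s ∈ grading a θ p) :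
    aug θ s = 0 := by
  suffices grading a θ p ≤ LinearMap.ker (aug θ).toLinearMap from this hs
  rw [grading, Submodule.span_le]
  rintro _ ⟨w, hw, rfl⟩
  cases w with
  | nil => exact absurd hw.symm hp
  | cons i w => simp [aug, lift_x]

theorem grading_zero (ha : ∀ i, 0 < a i) : grading a θ 0 = 1 := by
  apply le_antisymm
  · rw [grading, Submodule.span_le]
    rintro _ ⟨w, hw, rfl⟩
    cases w with
    | nil => simp [Submodule.one_le.1 le_rfl]
    | cons i w =>
      have : 0 ≤ (w.map fun i => (a i : ℤ)).sum := List.sum_nonneg (by simp)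
      have := ha i
      simp at hw
      omega
  · rw [Submodule.one_le]
    exact SetLike.GradedOne.one_mem

theorem isConnectedGraded (ha : ∀ i, 0 < a i) : IsConnectedGraded (grading a θ) (aug θ) where
  eq_bot _ hp := grading_eq_bot θ a hp
  zero_eq := grading_zero θ a ha
  aug_eq_zero _ _ hp hs := aug_eq_zero θ a hp hs

-- Since every a_i is at least 1, a word of degree p has length at most p, so its exponents lie in
-- {0, …, p}.
open Classical in
theorem grading_le_span (ha : ∀ i, 0 < a i) (p : ℕ) :
    grading a θ p ≤ Submodule.span k (((Fintype.piFinset fun _ : Fin (n + 1) =>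
      Finset.range (p + 1)).image fun α => mono θ (Finsupp.equivFunOnFinite.symm α) :) :
        Set (STheta θ)) := by
  rw [grading, Submodule.span_le]
  rintro _ ⟨w, hw, rfl⟩
  rw [word_eq]
  apply Submodule.smul_mem
  apply Submodule.subset_span
  simp only [Finset.coe_image, Set.mem_image, Finset.mem_coe, Fintype.mem_piFinset,
    Finset.mem_range]
  refine ⟨exponent w, fun i => ?_, by simp⟩
  have hlen : w.length ≤ p := by
    have : (w.length : ℤ) ≤ (w.map fun i => (a i : ℤ)).sum := by
      have := List.card_nsmul_le_sum (w.map fun i => (a i : ℤ)) 1 (by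
        simp only [List.mem_map, forall_exists_index, and_imp, forall_apply_eq_imp_iff₂]
        intro i _
        exact_mod_cast ha i)
      simpa using this
    omega
  have : exponent w i = w.count i := by simp [exponent]
  rw [this]
  have := w.count_le_length (a := i)
  omega

open Classical in
theorem polynomial_growth (ha : ∀ i, 0 < a i) : ∃ c δ : ℝ, ∀ p : ℕ, 0 < p →
    Module.Finite k (grading a θ p) ∧
      (Module.finrank k (grading a θ p) : ℝ) ≤ c * (p : ℝ) ^ δ := by
  -- There are (p + 1)^{n+1} exponent vectors with entries at most p, and p + 1 ≤ 2p for p ≥ 1.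
  refine ⟨2 ^ (n + 1), (n + 1 : ℕ), fun p hp => ?_⟩
  have h := grading_le_span θ a ha p
  refine ⟨Submodule.finiteDimensional_of_le h, ?_⟩
  have h₁ := (Submodule.finrank_mono h).trans (finrank_span_finset_le_card _)
  have h₂ := h₁.trans Finset.card_image_le
  rw [Fintype.card_piFinset_const, Finset.card_range] at h₂
  rw [Real.rpow_natCast, ← mul_pow]
  have h₃ : (p + 1) ^ (n + 1) ≤ (2 * p) ^ (n + 1) := Nat.pow_le_pow_left (by omega) _
  exact_mod_cast h₂.trans h₃

end STheta

/-! ### Complexes of Koszul type -/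

namespace KoszulType

/-! ### Koszul differentials with operator coefficients -/

section Differential

variable {R X : Type*} [Ring R] [AddCommGroup X] [Module R X] {ι : Type*} [LinearOrder ι]

/-- The Koszul sign `(-1)^s`, where `i` is preceded by exactly `s` elements of `I`. -/
def sign (I : Finset ι) (i : ι) : ℤ := (-1) ^ (I.filter (· < i)).card

/-- The smaller index i counts among the predecessors of j, while j does not count among those of i;
so exactly one sign changes. -/
theorem sign_mul_sign_of_lt {J : Finset ι} {i j : ι} (hi : i ∉ J) (hij : i < j) :
    sign (insert i J) i * sign (insert j (insert i J)) j =
      -(sign (insert j J) j * sign (insert j (insert i J)) i) := by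
  have hi' : i ∉ J.filter (· < j) := by simp [hi]
  simp only [sign, Finset.filter_insert, lt_irrefl, hij, hij.not_gt, if_true, if_false,
    Finset.card_insert_of_notMem hi', pow_succ]
  ring

theorem sign_mul_sign {J : Finset ι} {i j : ι} (hi : i ∉ J) (hj : j ∉ J) (hij : i ≠ j) :
    sign (insert i J) i * sign (insert j (insert i J)) j =
      -(sign (insert j J) j * sign (insert i (insert j J)) i) := by
  rcases hij.lt_or_gt with h | h
  · rw [sign_mul_sign_of_lt hi h, Finset.insert_comm]
  · rw [sign_mul_sign_of_lt hj h, neg_neg, Finset.insert_comm]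

variable [Fintype ι]

/-- The differential of the Koszul type complex with operators `C`:
`(d f)(J) = ∑_{i ∉ J} ± C_{J ∪ i, i} f(J ∪ i)`. -/
def d (C : Finset ι → ι → X →ₗ[R] X) : (Finset ι → X) →ₗ[R] (Finset ι → X) :=
  LinearMap.pi fun J => ∑ i ∈ Jᶜ,
    (sign (insert i J) i • C (insert i J) i) ∘ₗ LinearMap.proj (insert i J)

theorem d_apply (C : Finset ι → ι → X →ₗ[R] X) (f : Finset ι → X) (J : Finset ι) :
    d C f J = ∑ i ∈ Jᶜ, sign (insert i J) i • C (insert i J) i (f (insert i J)) := by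
  simp [d]

/-- The terms that remove i and j in the two possible orders have equal operators by `hC` and
opposite signs, so they cancel in pairs. -/
theorem d_d (C : Finset ι → ι → X →ₗ[R] X)
    (hC : ∀ (J : Finset ι) (i j : ι), i ∉ J → j ∉ J → i ≠ j → ∀ y,
      C (insert i J) i (C (insert j (insert i J)) j y) =
        C (insert j J) j (C (insert i (insert j J)) i y)) (f : Finset ι → X) :
    d C (d C f) = 0 := by
  funext J
  simp only [d_apply, map_sum, map_zsmul, Finset.smul_sum, smul_smul, Pi.zero_apply]
  rw [Finset.sum_sigma']
  refine Finset.sum_involution (fun p _ => ⟨p.2, p.1⟩) ?_ ?_ ?_ ?_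
  · rintro ⟨i, j⟩ h
    simp only [Finset.mem_sigma, Finset.mem_compl, Finset.mem_insert, not_or] at h
    dsimp only
    rw [sign_mul_sign h.1 h.2.2 (Ne.symm h.2.1), hC J i j h.1 h.2.2 (Ne.symm h.2.1),
      Finset.insert_comm i j J, neg_smul, neg_add_cancel]
  · rintro ⟨i, j⟩ h _ e
    simp only [Finset.mem_sigma, Finset.mem_compl, Finset.mem_insert, not_or] at h
    simp only [Sigma.mk.injEq, heq_eq_eq] at e
    exact h.2.1 e.1
  · rintro ⟨i, j⟩ h
    simp only [Finset.mem_sigma, Finset.mem_compl, Finset.mem_insert, not_or] at h ⊢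
    exact ⟨h.2.2, Ne.symm h.2.1, h.1⟩
  · intros
    rfl

end Differential

/-! ### Contraction in each multidegree -/

section Acyclic

open Classical in
/-- An element of a nonempty set. -/
noncomputable def pick {ι : Type*} [Nonempty ι] (s : Finset ι) : ι :=
  if h : s.Nonempty then h.choose else Classical.arbitrary ι

theorem pick_mem {ι : Type*} [Nonempty ι] {s : Finset ι} (h : s.Nonempty) : pick s ∈ s := by
  rw [pick, dif_pos h]
  exact h.choose_spec

variable {ι : Type*} [DecidableEq ι]

/-- The set of indices that occur in `J` or in the exponent vector `β`. -/
def supp (J : Finset ι) (β : ι →₀ ℕ) : Finset ι := J ∪ β.support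

theorem mem_supp {J : Finset ι} {β : ι →₀ ℕ} {i : ι} : i ∈ supp J β ↔ i ∈ J ∨ β i ≠ 0 := by
  simp [supp]

/-- Moving one unit of i from β into J keeps the multidegree 1_J + β, whose support is `supp J β`.
Consequently `pick` chooses the same index throughout a multidegree. -/
theorem supp_insert {J : Finset ι} {β : ι →₀ ℕ} {i : ι} (hi : β i ≠ 0) :
    supp (insert i J) (β - Finsupp.single i 1) = supp J β := by
  ext j
  by_cases h : j = i
  · subst h
    simp [supp, hi]
  · simp [supp, h]

theorem supp_erase {J : Finset ι} {β : ι →₀ ℕ} {i : ι} (hi : i ∈ J) :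
    supp (J.erase i) (β + Finsupp.single i 1) = supp J β := by
  ext j
  by_cases h : j = i
  · subst h
    simp [supp, hi]
  · simp [supp, h]

variable {N : Type*} [AddCommGroup N]

/-- The differential of a multigraded Koszul type complex, in coordinates. -/
noncomputable def shiftD [Fintype ι] (u : Finset ι → ι → (ι →₀ ℕ) → N ≃+ N)
    (f : Finset ι → (ι →₀ ℕ) → N) (J : Finset ι) (β : ι →₀ ℕ) : N :=
  ∑ i ∈ Jᶜ with β i ≠ 0, u J i β (f (insert i J) (β - Finsupp.single i 1))

/-- A contracting homotopy for `shiftD`. -/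
noncomputable def shiftH [Nonempty ι] (u : Finset ι → ι → (ι →₀ ℕ) → N ≃+ N)
    (f : Finset ι → (ι →₀ ℕ) → N) (J : Finset ι) (β : ι →₀ ℕ) : N :=
  if pick (supp J β) ∈ J then
    (u (J.erase (pick (supp J β))) (pick (supp J β))
      (β + Finsupp.single (pick (supp J β)) 1)).symm
      (f (J.erase (pick (supp J β))) (β + Finsupp.single (pick (supp J β)) 1))
  else 0

theorem shiftD_sub [Fintype ι] (u : Finset ι → ι → (ι →₀ ℕ) → N ≃+ N)
    (f g : Finset ι → (ι →₀ ℕ) → N) (J : Finset ι) (β : ι →₀ ℕ) :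
    shiftD u (fun J β => f J β - g J β) J β = shiftD u f J β - shiftD u g J β := by
  simp [shiftD, map_sub]

theorem exists_of_shiftH_ne_zero [Nonempty ι]
    (u : Finset ι → ι → (ι →₀ ℕ) → N ≃+ N) (f : Finset ι → (ι →₀ ℕ) → N) {J : Finset ι}
    {β : ι →₀ ℕ} (h : shiftH u f J β ≠ 0) :
    ∃ i ∈ J, f (J.erase i) (β + Finsupp.single i 1) ≠ 0 := by
  rw [shiftH] at h
  split_ifs at h with hJ
  · exact ⟨_, hJ, fun h' => h (by rw [h', map_zero])⟩
  · exact absurd rfl h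

variable [Fintype ι] [Nonempty ι] (u : Finset ι → ι → (ι →₀ ℕ) → N ≃+ N)
  (f : Finset ι → (ι →₀ ℕ) → N)

theorem shiftD_eq_of_pick_notMem {J : Finset ι} {β : ι →₀ ℕ} (h₀ : (supp J β).Nonempty)
    (h : pick (supp J β) ∉ J)
    (hf : ∀ i, i ∉ J → β i ≠ 0 → i ≠ pick (supp J β) →
      f (insert i J) (β - Finsupp.single i 1) = 0) :
    shiftD u f J β = u J (pick (supp J β)) β
      (f (insert (pick (supp J β)) J) (β - Finsupp.single (pick (supp J β)) 1)) := by
  have hβ : β (pick (supp J β)) ≠ 0 := (mem_supp.1 (pick_mem h₀)).resolve_left h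
  rw [shiftD, Finset.sum_eq_single (pick (supp J β))]
  · intro i hi hne
    simp only [Finset.mem_filter, Finset.mem_compl] at hi
    rw [hf i hi.1 hi.2 hne, map_zero]
  · simp [h, hβ]

/-- Only the summand of the picked index survives: for any other i the picked index is still absent
from J ∪ i, where the homotopy vanishes. In the surviving summand the unit cancels its inverse. -/
theorem shiftD_shiftH {J : Finset ι} {β : ι →₀ ℕ} (h₀ : (supp J β).Nonempty)
    (h : pick (supp J β) ∉ J) : shiftD u (shiftH u f) J β = f J β := by
  have hβ : β (pick (supp J β)) ≠ 0 := (mem_supp.1 (pick_mem h₀)).resolve_left h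
  rw [shiftD_eq_of_pick_notMem u _ h₀ h]
  · rw [shiftH, supp_insert hβ, if_pos (Finset.mem_insert_self _ _),
      Finset.erase_insert h, tsub_add_cancel_of_le, AddEquiv.apply_symm_apply]
    simpa [Nat.one_le_iff_ne_zero] using hβ
  · intro i _ hi hne
    rw [shiftH, supp_insert hi, if_neg]
    simp [h, hne.symm]

/-- If the picked index i lies in J, the differential at (J \ i, β + e_i) reduces to a unit times
f(J, β), as its other terms sit at sets without i. So a cycle that vanishes at sets without the
picked index vanishes altogether. This avoids checking a homotopy identity for the scalars. -/
theorem eq_zero_of_shiftD_eq_zero (hf : ∀ J β, (supp J β).Nonempty → pick (supp J β) ∉ J →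
    f J β = 0) (hD : ∀ J β, shiftD u f J β = 0) (J : Finset ι) (β : ι →₀ ℕ)
    (h₀ : (supp J β).Nonempty) : f J β = 0 := by
  by_cases h : pick (supp J β) ∈ J
  · set i := pick (supp J β) with hi
    have hs : supp (J.erase i) (β + Finsupp.single i 1) = supp J β := supp_erase h
    have := hD (J.erase i) (β + Finsupp.single i 1)
    rw [shiftD_eq_of_pick_notMem u f (by rwa [hs]) (by rw [hs]; simp [hi])] at this
    · rw [hs, ← hi] at this
      simpa [Finset.insert_erase h] using this
    · intro l hl hβ hne
      rw [hs, ← hi] at hne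
      apply hf
      · rwa [supp_insert hβ, hs]
      · rw [supp_insert hβ, hs, ← hi]
        simp [hne.symm]
  · exact hf J β h₀ h

/-- Acyclicity of multigraded Koszul type complexes. -/
theorem exists_eq {X : Type*} [AddCommGroup X] (φ : X ≃+ ((ι →₀ ℕ) →₀ N))
    (T : (Finset ι → X) → (Finset ι → X))
    (hT : ∀ f J β, φ (T f J) β = shiftD u (fun J β => φ (f J) β) J β)
    (hTT : ∀ f, T (T f) = 0) (f : Finset ι → X) (hf : T f = 0) :
    ∃ g : Finset ι → X,
      (∀ J β, φ (g J) β ≠ 0 → ∃ i ∈ J, φ (f (J.erase i)) (β + Finsupp.single i 1) ≠ 0) ∧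
      ∀ J β, (J ≠ ∅ ∨ β ≠ 0) → φ (f J) β = φ (T g J) β := by
  let F : Finset ι → (ι →₀ ℕ) → N := fun J β => φ (f J) β
  have hfin : ∀ J, (Function.support (shiftH u F J)).Finite := by
    intro J
    refine Set.Finite.subset (s := ⋃ i ∈ J, (· + Finsupp.single i 1) ⁻¹'
      ((φ (f (J.erase i))).support : Set (ι →₀ ℕ))) ?_ ?_
    · refine J.finite_toSet.biUnion fun i _ => Set.Finite.preimage ?_ (Finset.finite_toSet _)
      exact (add_left_injective _).injOn
    · intro β hβ
      obtain ⟨i, hi, h⟩ := exists_of_shiftH_ne_zero u F hβ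
      simp only [Set.mem_iUnion]
      exact ⟨i, hi, by simpa using h⟩
  let g : Finset ι → X := fun J => φ.symm (Finsupp.ofSupportFinite _ (hfin J))
  have hg : (fun J β => φ (g J) β) = shiftH u F := by
    funext J β
    simp only [g, AddEquiv.apply_symm_apply]
    rfl
  have hg' : ∀ J β, φ (g J) β = shiftH u F J β := fun J β => congrFun (congrFun hg J) β
  refine ⟨g, fun J β h => exists_of_shiftH_ne_zero u F (by rwa [hg'] at h), ?_⟩
  -- The cycle f - T g vanishes wherever the picked index is absent, hence in every nonzero
  -- multidegree.
  have key := eq_zero_of_shiftD_eq_zero u (fun J β => F J β - φ (T g J) β)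
    (by
      intro J β h₀ h
      rw [hT, hg, shiftD_shiftH u F h₀ h, sub_self])
    (by
      intro J β
      rw [shiftD_sub, ← hT, ← hT, hTT, hf]
      simp)
  intro J β h
  rw [← sub_eq_zero]
  apply key
  rw [supp]
  rcases h with h | h
  · exact (Finset.nonempty_iff_ne_empty.2 h).mono Finset.subset_union_left
  · exact (Finsupp.support_nonempty_iff.2 h).mono Finset.subset_union_right

end Acyclic

end KoszulType

/-! ### Acyclicity for shift operators and their perturbations -/

namespace KoszulType

/-- Acyclicity of the Koszul type complex with operators `C` that, in suitable coordinates, shift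
the exponent vectors and multiply by invertible scalars. -/
theorem d_exact {k R X N ι : Type*} [Field k] [Ring R] [AddCommGroup X] [Module R X]
    [AddCommGroup N] [Module k N] [Fintype ι] [LinearOrder ι] [Nonempty ι]
    (C : Finset ι → ι → X →ₗ[R] X)
    (hC : ∀ (J : Finset ι) (i j : ι), i ∉ J → j ∉ J → i ≠ j → ∀ y,
      C (insert i J) i (C (insert j (insert i J)) j y) =
        C (insert j J) j (C (insert i (insert j J)) i y))
    (φ : X ≃+ ((ι →₀ ℕ) →₀ N)) (c : Finset ι → ι → (ι →₀ ℕ) → kˣ)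
    (hφ : ∀ I i y β, φ (C I i y) β =
      if β i = 0 then 0 else (c I i β : k) • φ y (β - Finsupp.single i 1))
    (f : Finset ι → X) (hf : d C f = 0) :
    ∃ g : Finset ι → X,
      (∀ J β, φ (g J) β ≠ 0 → ∃ i ∈ J, φ (f (J.erase i)) (β + Finsupp.single i 1) ≠ 0) ∧
      ∀ J β, (J ≠ ∅ ∨ β ≠ 0) → φ (f J) β = φ (d C g J) β := by
  -- The Koszul sign is absorbed into the unit, since the contraction needs only invertibility.
  refine exists_eq (fun J i β => DistribMulAction.toAddEquiv N
    ((-1 : kˣ) ^ ((insert i J).filter (· < i)).card * c (insert i J) i β)) φ (d C) ?_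
    (d_d C hC) f hf
  intro f J β
  rw [d_apply, map_sum, Finsupp.finsetSum_apply, shiftD, Finset.sum_filter]
  refine Finset.sum_congr rfl fun i _ => ?_
  rw [map_zsmul, Finsupp.smul_apply, hφ, ite_not]
  split_ifs with h
  · simp
  · rw [DistribMulAction.toAddEquiv_apply, Units.smul_def, ← Int.cast_smul_eq_zsmul k, smul_smul]
    simp [sign]

/-- Acyclicity of the Koszul type complex with operators `C₀ - C₁`, if `C₀` is as in `d_exact` and
`C₁` does not enlarge the set of exponent vectors. -/
theorem d_sub_exact {k R X N ι : Type*} [Field k] [Ring R] [AddCommGroup X] [Module R X]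
    [AddCommGroup N] [Module k N] [Fintype ι] [LinearOrder ι] [Nonempty ι]
    (C C₀ : Finset ι → ι → X →ₗ[R] X)
    (hC : ∀ (J : Finset ι) (i j : ι), i ∉ J → j ∉ J → i ≠ j → ∀ y,
      C (insert i J) i (C (insert j (insert i J)) j y) =
        C (insert j J) j (C (insert i (insert j J)) i y))
    (hC₀ : ∀ (J : Finset ι) (i j : ι), i ∉ J → j ∉ J → i ≠ j → ∀ y,
      C₀ (insert i J) i (C₀ (insert j (insert i J)) j y) =
        C₀ (insert j J) j (C₀ (insert i (insert j J)) i y))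
    (φ : X ≃+ ((ι →₀ ℕ) →₀ N)) (c : Finset ι → ι → (ι →₀ ℕ) → kˣ)
    (hφ : ∀ I i y β, φ (C₀ I i y) β =
      if β i = 0 then 0 else (c I i β : k) • φ y (β - Finsupp.single i 1))
    (hφ' : ∀ I i y β, φ y β = 0 → φ (C I i y) β = φ (C₀ I i y) β)
    (f : Finset ι → X) (hf : d C f = 0) :
    ∃ g : Finset ι → X, ∀ J β, (J ≠ ∅ ∨ β ≠ 0) → φ (f J) β = φ (d C g J) β := by
  have hdC : ∀ (f : Finset ι → X) J β, (∀ i ∉ J, φ (f (insert i J)) β = 0) →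
      φ (d C f J) β = φ (d C₀ f J) β := by
    intro f J β h
    simp only [d_apply, map_sum, map_zsmul, Finsupp.finsetSum_apply, Finsupp.smul_apply]
    exact Finset.sum_congr rfl fun i hi => by rw [hφ' _ _ _ _ (h i (Finset.mem_compl.1 hi))]
  have hdC₀ : ∀ (f f' : Finset ι → X) J β, (∀ i ∉ J, β i ≠ 0 →
      φ (f (insert i J)) (β - Finsupp.single i 1) =
        φ (f' (insert i J)) (β - Finsupp.single i 1)) →
      φ (d C₀ f J) β = φ (d C₀ f' J) β := by
    intro f f' J β h
    simp only [d_apply, map_sum, map_zsmul, Finsupp.finsetSum_apply, Finsupp.smul_apply, hφ]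
    refine Finset.sum_congr rfl fun i hi => ?_
    split_ifs with h'
    · rfl
    · rw [h i (Finset.mem_compl.1 hi) h']
  -- The shift operators preserve this weight. The perturbation keeps β while J loses an element, so
  -- it lowers the weight by one.
  let wt : Finset ι → (ι →₀ ℕ) → ℕ := fun J β => J.card + β.degree
  have wt_insert : ∀ J β i, i ∉ J → wt (insert i J) β = wt J β + 1 := by
    intro J β i hi
    simp only [wt, Finset.card_insert_of_notMem hi]
    omega
  have wt_shift : ∀ J β i, i ∉ J → β i ≠ 0 →
      wt (insert i J) (β - Finsupp.single i 1) = wt J β := by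
    intro J β i hi hβ
    have h : β.degree = (β - Finsupp.single i 1).degree + 1 := by
      conv_lhs => rw [← tsub_add_cancel_of_le (a := Finsupp.single i 1) (b := β)
        (by simpa [Nat.one_le_iff_ne_zero] using hβ)]
      simp
    simp only [wt, Finset.card_insert_of_notMem hi, h]
    omega
  have wt_erase : ∀ J β i, i ∈ J → wt (J.erase i) (β + Finsupp.single i 1) = wt J β := by
    intro J β i hi
    have := Finset.card_erase_add_one hi
    simp only [wt, map_add, Finsupp.degree_single]
    omega
  have key : ∀ (w : ℕ) (f : Finset ι → X), d C f = 0 →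
      (∀ J β, w ≤ wt J β → φ (f J) β = 0) →
      ∃ g : Finset ι → X, ∀ J β, (J ≠ ∅ ∨ β ≠ 0) → φ (f J) β = φ (d C g J) β := by
    intro w
    induction w with
    | zero => exact fun f _ h => ⟨0, fun J β _ => by simp [h J β (Nat.zero_le _)]⟩
    | succ w ih =>
      intro f hf hw
      classical
      -- The part of `f` of top weight w is a cycle for `C₀`: at weight w the perturbation draws
      -- only on values of `f` at weight w + 1, which vanish.
      let fw : Finset ι → X := fun J => φ.symm ((φ (f J)).filter fun β => wt J β = w)
      have hfw : ∀ J β, φ (fw J) β = if wt J β = w then φ (f J) β else 0 := by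
        intro J β
        simp [fw, Finsupp.filter_apply]
      obtain ⟨g, hg, hg'⟩ := d_exact C₀ hC₀ φ c hφ fw (by
        funext J
        apply φ.injective
        ext β
        rw [Pi.zero_apply, map_zero, Finsupp.zero_apply]
        by_cases h : wt J β = w
        · rw [hdC₀ fw f, ← hdC, hf]
          · simp
          · intro i hi
            apply hw
            rw [wt_insert J β i hi, h]
          · intro i hi hβ
            rw [hfw, if_pos ((wt_shift J β i hi hβ).trans h)]
        · rw [hdC₀ fw 0]
          · simp
          · intro i hi hβ
            rw [hfw, wt_shift J β i hi hβ, if_neg h]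
            simp)
      -- The support condition in `d_exact` keeps `g` in weight w, so that `d C g` agrees with `d C₀
      -- g` in weights at least w.
      have hgw : ∀ J β, wt J β ≠ w → φ (g J) β = 0 := by
        intro J β h
        by_contra h'
        obtain ⟨i, hi, h''⟩ := hg J β h'
        rw [hfw, wt_erase J β i hi, if_neg h] at h''
        exact h'' rfl
      -- Nothing is known about the remainder at (∅, 0). It is split off as `e`, which is a cycle
      -- because the differential never uses the value at ∅.
      let m₀ := φ (f ∅ - d C g ∅) 0
      let e : Finset ι → X := Pi.single ∅ (φ.symm (Finsupp.single 0 m₀))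
      have he : ∀ J β, (J ≠ ∅ ∨ β ≠ 0) → φ (e J) β = 0 := by
        intro J β h
        by_cases hJ : J = ∅
        · subst hJ
          simp [e, Finsupp.single_eq_of_ne (h.resolve_left (by simp))]
        · simp [e, Pi.single_eq_of_ne hJ]
      have hde : d C e = 0 := by
        funext J
        simp [d_apply, e]
      obtain ⟨g', hg''⟩ := ih (f - d C g - e) (by rw [map_sub, map_sub, hf, d_d C hC, hde]; simp)
        (by
          intro J β h
          simp only [Pi.sub_apply, map_sub, Finsupp.sub_apply]
          by_cases h₀ : J ≠ ∅ ∨ β ≠ 0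
          · rw [he J β h₀, sub_zero]
            have h₁ : φ (d C g J) β = φ (d C₀ g J) β := by
              apply hdC
              intro i hi
              apply hgw
              rw [wt_insert J β i hi]
              omega
            rw [h₁, ← hg' J β h₀, hfw]
            split_ifs with h₂
            · exact sub_self _
            · rw [hw J β (by omega), sub_zero]
          · push Not at h₀
            obtain ⟨rfl, rfl⟩ := h₀
            simp [e, m₀])
      refine ⟨g + g', fun J β h => ?_⟩
      have := hg'' J β h
      simp only [Pi.sub_apply, map_sub, Finsupp.sub_apply, he J β h, sub_zero] at this
      rw [map_add, Pi.add_apply, map_add, Finsupp.add_apply, ← this]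
      abel
  -- This bound exceeds every weight that occurs in `f`.
  refine key (Finset.univ.sup fun J => (φ (f J)).support.sup (wt J) + 1) f hf ?_
  intro J β h
  by_contra h'
  have h₁ : wt J β ≤ (φ (f J)).support.sup (wt J) := Finset.le_sup (by simpa using h')
  have h₂ := Finset.le_sup (f := fun J => (φ (f J)).support.sup (wt J) + 1) (Finset.mem_univ J)
  omega

/-! ### Restriction to subsets of fixed size -/

section Subsets

open STheta

variable {R X : Type*} [Ring R] [AddCommGroup X] [Module R X] {n : ℕ}

/-- Extension by zero of a function on the `m`-element subsets. -/
def extend {m : ℕ} (f : Subsets n m → X) (J : Finset (Fin (n + 1))) : X :=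
  if h : J.card = m then f ⟨J, h⟩ else 0

@[simp]
theorem extend_coe {m : ℕ} (f : Subsets n m → X) (J : Subsets n m) : extend f J.1 = f J := by
  rw [extend, dif_pos J.2]

theorem extend_of_ne {m : ℕ} (f : Subsets n m → X) {J : Finset (Fin (n + 1))}
    (h : J.card ≠ m) : extend f J = 0 := by
  rw [extend, dif_neg h]

theorem extend_add {m : ℕ} (f g : Subsets n m → X) : extend (f + g) = extend f + extend g := by
  funext J
  simp only [extend, Pi.add_apply]
  split_ifs <;> simp

theorem extend_smul {m : ℕ} (r : R) (f : Subsets n m → X) : extend (r • f) = r • extend f := by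
  funext J
  simp only [extend, Pi.smul_apply]
  split_ifs <;> simp

@[simp]
theorem extend_zero {m : ℕ} : extend (0 : Subsets n m → X) = 0 := by
  funext J
  simp [extend]

variable (C : Finset (Fin (n + 1)) → Fin (n + 1) → X →ₗ[R] X)

/-- The part of the differential `d` from the `m + 1`-element subsets to the `m`-element
subsets. -/
def dSub (m : ℕ) : (Subsets n (m + 1) → X) →ₗ[R] (Subsets n m → X) where
  toFun f J := d C (extend f) J.1
  map_add' f g := by
    funext J
    rw [extend_add, map_add]
    rfl
  map_smul' r f := by
    funext J
    rw [extend_smul, map_smul]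
    rfl

theorem dSub_apply {m : ℕ} (f : Subsets n (m + 1) → X) (J : Subsets n m) :
    dSub C m f J = d C (extend f) J.1 := rfl

theorem extend_dSub {m : ℕ} (f : Subsets n (m + 1) → X) :
    extend (dSub C m f) = d C (extend f) := by
  funext J
  by_cases h : J.card = m
  · rw [extend, dif_pos h, dSub_apply]
  · rw [extend_of_ne _ h, d_apply, Finset.sum_eq_zero]
    intro i hi
    rw [extend_of_ne, map_zero, smul_zero]
    rw [Finset.card_insert_of_notMem (Finset.mem_compl.1 hi)]
    omega

/-- On an m-element set the differential sees only the values at (m + 1)-element sets, so the other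
values of a primitive may be discarded. -/
theorem dSub_restrict {m : ℕ} (g : Finset (Fin (n + 1)) → X) (J : Subsets n m) :
    dSub C m (fun I => g I.1) J = d C g J.1 := by
  rw [dSub_apply, d_apply, d_apply]
  refine Finset.sum_congr rfl fun i hi => ?_
  rw [extend, dif_pos]
  rw [Finset.card_insert_of_notMem (Finset.mem_compl.1 hi), J.2]

theorem d_extend_zero (f : Subsets n 0 → X) : d C (extend f) = 0 := by
  funext J
  rw [d_apply, Pi.zero_apply, Finset.sum_eq_zero]
  intro i hi
  rw [extend_of_ne, map_zero, smul_zero]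
  simp

theorem dSub_dSub (hC : ∀ (J : Finset (Fin (n + 1))) (i j : Fin (n + 1)), i ∉ J → j ∉ J →
      i ≠ j → ∀ y, C (insert i J) i (C (insert j (insert i J)) j y) =
        C (insert j J) j (C (insert i (insert j J)) i y))
    {m : ℕ} (f : Subsets n (m + 2) → X) : dSub C m (dSub C (m + 1) f) = 0 := by
  funext J
  rw [dSub_apply, extend_dSub, d_d C hC]
  rfl

/-- The pairs (J, i ∉ J) correspond to the pairs (I, i ∈ I) through I = J ∪ i; this is the form in
which `koszulD` is written. -/
theorem dSub_eq_sum {m : ℕ} (f : Subsets n (m + 1) → X) (J : Subsets n m) :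
    dSub C m f J = ∑ I : Subsets n (m + 1), ∑ i : I.1,
      if I.erase i = J then sign I.1 i.1 • C I.1 i.1 (f I) else 0 := by
  rw [dSub_apply, d_apply, Finset.sum_sigma', ← Finset.sum_filter]
  refine Finset.sum_bij' (fun i hi => ⟨⟨insert i J.1, by
    rw [Finset.card_insert_of_notMem (Finset.mem_compl.1 hi), J.2]⟩,
    ⟨i, Finset.mem_insert_self _ _⟩⟩) (fun p _ => p.2.1) ?_ ?_ ?_ ?_ ?_
  · intro i hi
    simp only [Finset.mem_filter, Finset.mem_sigma, Finset.mem_univ, and_self, true_and]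
    exact Subtype.ext (Finset.erase_insert (Finset.mem_compl.1 hi))
  · rintro ⟨I, i⟩ h
    simp only [Finset.mem_filter] at h
    rw [← h.2]
    simp [Subsets.erase]
  · intros
    rfl
  · rintro ⟨⟨I, hI⟩, ⟨i, hi⟩⟩ h
    simp only [Finset.mem_filter] at h
    obtain rfl := h.2
    have : insert i (I.erase i) = I := Finset.insert_erase hi
    exact Sigma.ext (Subtype.ext this) ((Subtype.heq_iff_coe_eq (by simp [Subsets.erase, this])).2
      rfl)
  · intro i hi
    dsimp only
    rw [extend, dif_pos]

variable {C}
  {N : Type*} [AddCommGroup N] (φ : X ≃+ ((Fin (n + 1) →₀ ℕ) →₀ N))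

/-- Sets with m + 1 elements are nonempty, so the exceptional coordinate (∅, 0) does not occur. -/
theorem exists_dSub_eq {m : ℕ} (hex : ∀ f, d C f = 0 → ∃ g, ∀ J β,
      (J ≠ ∅ ∨ β ≠ 0) → φ (f J) β = φ (d C g J) β)
    (f : Subsets n (m + 1) → X) (hf : dSub C m f = 0) :
    ∃ g, dSub C (m + 1) g = f := by
  obtain ⟨g, hg⟩ := hex (extend f) (by rw [← extend_dSub, hf, extend_zero])
  refine ⟨fun I => g I.1, funext fun J => ?_⟩
  rw [dSub_restrict]
  apply φ.injective
  ext β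
  rw [← hg J.1 β (Or.inl ?_), extend_coe]
  rintro h
  simpa [h] using J.2

theorem exists_sub_dSub_eq (hex : ∀ f, d C f = 0 → ∃ g, ∀ J β,
      (J ≠ ∅ ∨ β ≠ 0) → φ (f J) β = φ (d C g J) β)
    (f : Subsets n 0 → X) :
    ∃ g r, f - dSub C 0 g = fun _ => φ.symm (Finsupp.single 0 r) := by
  obtain ⟨g, hg⟩ := hex (extend f) (d_extend_zero C f)
  refine ⟨fun I => g I.1, φ (f ⟨∅, rfl⟩ - d C g ∅) 0, funext fun J => ?_⟩
  obtain rfl : J = ⟨∅, rfl⟩ := Subtype.ext (Finset.card_eq_zero.1 J.2)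
  rw [Pi.sub_apply, dSub_restrict, AddEquiv.eq_symm_apply]
  ext β
  by_cases hβ : β = 0
  · simp [hβ]
  · rw [Finsupp.single_eq_of_ne hβ, map_sub, Finsupp.sub_apply, ← hg ∅ β (Or.inr hβ),
      ← extend_coe f, sub_self]

end Subsets

end KoszulType

namespace STheta

variable {k : Type u} [Field k] {n : ℕ} (θ : Matrix (Fin (n + 1)) (Fin (n + 1)) kˣ)

open KoszulType

/-! ### The Koszul complex is a resolution -/

/-- For the LL and RR terms the surplus factors θ_ij and θ_ji are those in `hL` and `hR`. The mixed
terms agree directly because L and R commute and carry transposed products; for this reason the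
coefficient of R has θ_il where that of L has θ_li. -/
theorem koszul_comm {X : Type*} [AddCommGroup X] [Module k X]
    (L R : Fin (n + 1) → X →ₗ[k] X) (C : Finset (Fin (n + 1)) → Fin (n + 1) → X → X)
    (hC : ∀ I i y, C I i y =
      (∏ l ∈ I, (θ l i : k)) • L i y - (∏ l ∈ I, (θ i l : k)) • R i y)
    (hL : ∀ i j y, (θ i j : k) • L i (L j y) = (θ j i : k) • L j (L i y))
    (hR : ∀ i j y, (θ j i : k) • R i (R j y) = (θ i j : k) • R j (R i y))
    (hLR : ∀ i j y, L i (R j y) = R j (L i y))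
    (J : Finset (Fin (n + 1))) (i j : Fin (n + 1)) (hi : i ∉ J) (hj : j ∉ J) (hij : i ≠ j)
    (y : X) : C (insert i J) i (C (insert j (insert i J)) j y) =
        C (insert j J) j (C (insert i (insert j J)) i y) := by
  have hi' : i ∉ insert j J := by simp [hi, hij]
  have hj' : j ∉ insert i J := by simp [hj, hij.symm]
  simp only [hC, Finset.prod_insert hi, Finset.prod_insert hj, Finset.prod_insert hi',
    Finset.prod_insert hj', map_sub, map_smul, smul_sub, smul_smul, hLR j i, hLR i j]
  have h₁ := congrArg ((θ i i * θ j j * (∏ l ∈ J, (θ l i : k)) * ∏ l ∈ J, (θ l j : k)) • ·)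
    (hL i j y)
  have h₂ := congrArg ((θ i i * θ j j * (∏ l ∈ J, (θ i l : k)) * ∏ l ∈ J, (θ j l : k)) • ·)
    (hR i j y)
  simp only [smul_smul] at h₁ h₂
  linear_combination (norm := module) h₁ + h₂

/-- The components of the Koszul differential. -/
noncomputable def koszulC (I : Finset (Fin (n + 1))) (i : Fin (n + 1)) :
    STheta θ →ₗ[(STheta θ)ᵐᵒᵖ] STheta θ :=
  leftMulRight ((∏ j ∈ I, (θ j i : k)) • x θ i)

theorem koszulC_apply (I : Finset (Fin (n + 1))) (i : Fin (n + 1)) (y : STheta θ) :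
    koszulC θ I i y = (∏ j ∈ I, (θ j i : k)) • (x θ i * y) := smul_mul_assoc _ _ _

theorem koszulC_comm (J : Finset (Fin (n + 1))) (i j : Fin (n + 1)) (hi : i ∉ J) (hj : j ∉ J)
    (hij : i ≠ j) (y : STheta θ) :
    koszulC θ (insert i J) i (koszulC θ (insert j (insert i J)) j y) =
      koszulC θ (insert j J) j (koszulC θ (insert i (insert j J)) i y) := by
  refine koszul_comm θ (fun i => LinearMap.mulLeft k (x θ i)) (fun _ => 0)
    (fun I i y => koszulC θ I i y) ?_ ?_ ?_ ?_ J i j hi hj hij y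
  · intro I i y
    simp [koszulC_apply]
  · intro i j y
    simp only [LinearMap.mulLeft_apply]
    rw [← mul_assoc, ← smul_mul_assoc, x_comm, smul_mul_assoc, mul_assoc]
  · simp
  · simp

theorem koszulD_eq (m : ℕ) : koszulD θ m = dSub (koszulC θ) m := by
  refine LinearMap.ext fun f => funext fun J => ?_
  rw [dSub_eq_sum, koszulD]
  simp only [LinearMap.sum_apply, Finset.sum_apply]
  refine Finset.sum_congr rfl fun I _ => Finset.sum_congr rfl fun i _ => ?_
  simp only [LinearMap.comp_apply, LinearMap.proj_apply, LinearMap.single_apply, Pi.single_apply,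
    eq_comm (a := J)]
  congr 1
  rw [koszulC_apply, sign, ← Int.cast_smul_eq_zsmul k, smul_smul]
  simp [leftMulRight]

theorem repr_koszulC (I : Finset (Fin (n + 1))) (i : Fin (n + 1)) (y : STheta θ)
    (β : Fin (n + 1) →₀ ℕ) : (basis θ).repr (koszulC θ I i y) β =
      if β i = 0 then 0 else
        (((∏ j ∈ I, θ j i) * stepCoeff θ i (β - Finsupp.single i 1) : kˣ) : k) •
          (basis θ).repr y (β - Finsupp.single i 1) := by
  rw [koszulC_apply, map_smul, Finsupp.smul_apply]
  have := repr_apply_of_shift θ (Finsupp.single i 1) (LinearMap.mulLeft k (x θ i))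
    (fun β => stepCoeff θ i β) (x_mul_mono θ i) y β
  rw [LinearMap.mulLeft_apply] at this
  rw [this]
  simp only [Finsupp.single_le_iff, Nat.one_le_iff_ne_zero, ite_not, smul_eq_mul]
  split_ifs <;> simp [mul_assoc]

theorem koszulD_d (m : ℕ) (f : Koszul θ (m + 2)) : koszulD θ m (koszulD θ (m + 1) f) = 0 := by
  rw [koszulD_eq, koszulD_eq, dSub_dSub _ (koszulC_comm θ)]

theorem koszulC_exact (f : Finset (Fin (n + 1)) → STheta θ) (hf : d (koszulC θ) f = 0) :
    ∃ g : Finset (Fin (n + 1)) → STheta θ, ∀ J β, (J ≠ ∅ ∨ β ≠ 0) →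
      (basis θ).repr (f J) β = (basis θ).repr (d (koszulC θ) g J) β :=
  let ⟨g, _, hg⟩ := d_exact (koszulC θ) (koszulC_comm θ) (basis θ).repr.toAddEquiv _
    (repr_koszulC θ) f hf
  ⟨g, hg⟩

theorem koszulD_exact (m : ℕ) (f : Koszul θ (m + 1)) (hf : koszulD θ m f = 0) :
    ∃ g, koszulD θ (m + 1) g = f := by
  rw [koszulD_eq] at hf ⊢
  exact exists_dSub_eq (basis θ).repr.toAddEquiv (koszulC_exact θ) f hf

theorem aug_x (i : Fin (n + 1)) : aug θ (x θ i) = 0 := lift_x _ _ _ _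

theorem aug_d_koszulC (g : Finset (Fin (n + 1)) → STheta θ) (J : Finset (Fin (n + 1))) :
    aug θ (d (koszulC θ) g J) = 0 := by
  simp [d_apply, map_sum, koszulC_apply, aug_x]

theorem koszulAug_koszulD (f : Koszul θ 1) : koszulAug θ (koszulD θ 0 f) = 0 := by
  rw [koszulD_eq]
  exact aug_d_koszulC θ _ _

/-- Modulo boundaries an element of K_0 is a scalar, and the augmentation returns that scalar. -/
theorem koszulAug_exact (f : Koszul θ 0) (hf : koszulAug θ f = 0) :
    ∃ g, koszulD θ 0 g = f := by
  obtain ⟨g, r, hg⟩ := exists_sub_dSub_eq (basis θ).repr.toAddEquiv (koszulC_exact θ) f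
  rw [← koszulD_eq] at hg
  have h := congrArg (koszulAug θ) hg
  have h₁ : koszulAug θ (fun _ => (basis θ).repr.toAddEquiv.symm (Finsupp.single 0 r)) = r := by
    change aug θ ((basis θ).repr.symm (Finsupp.single 0 r)) = r
    simp [mono_zero]
  rw [map_sub, hf, koszulAug_koszulD, sub_zero, h₁] at h
  refine ⟨g, (sub_eq_zero.1 (hg.trans ?_)).symm⟩
  rw [← h]
  funext
  exact (congrArg _ (Finsupp.single_zero 0)).trans (map_zero _)

theorem koszulAug_surjective : Function.Surjective (koszulAug θ) := fun c =>
  ⟨fun _ => algebraMap k _ c, (aug θ).commutes c⟩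

theorem koszulD_mem (a : Fin (n + 1) → ℕ) (m : ℕ) (p : ℤ) (f : Koszul θ (m + 1))
    (hf : f ∈ koszulGrading a θ (m + 1) p) : koszulD θ m f ∈ koszulGrading a θ m p := by
  rw [koszulD_eq]
  intro J _
  dsimp only
  rw [dSub_apply, d_apply]
  refine Submodule.sum_mem _ fun i hi => Submodule.smul_of_tower_mem _ _ ?_
  rw [koszulC_apply]
  apply Submodule.smul_mem
  have hi := Finset.mem_compl.1 hi
  have hc : (insert i J.1).card = m + 1 := by rw [Finset.card_insert_of_notMem hi, J.2]
  have h := hf ⟨insert i J.1, hc⟩ trivial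
  rw [extend, dif_pos hc]
  have := SetLike.mul_mem_graded (x_mem a θ i) h
  convert this using 2
  rw [Finset.sum_insert hi]
  ring

theorem isKoszulResolution (a : Fin (n + 1) → ℕ) : IsKoszulResolution a θ where
  d_mem := koszulD_mem θ a
  aug_eq_zero p f hp hf := by
    refine aug_eq_zero θ a hp ?_
    simpa using hf ⟨∅, rfl⟩ trivial
  injective := by
    rw [injective_iff_map_eq_zero]
    intro f hf
    obtain ⟨g, rfl⟩ := koszulD_exact θ n f hf
    -- The kernel is the image of the next term, which is zero since n + 1 indices have no subset of
    -- size n + 2.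
    have : IsEmpty (Subsets n (n + 1 + 1)) := ⟨fun I => by
      have := I.1.card_le_univ
      rw [I.2, Fintype.card_fin] at this
      omega⟩
    rw [Subsingleton.elim g 0, map_zero]
  exact m f := ⟨koszulD_exact θ m f, by rintro ⟨g, rfl⟩; exact koszulD_d θ m g⟩
  exact_aug f := ⟨koszulAug_exact θ f, by rintro ⟨g, rfl⟩; exact koszulAug_koszulD θ g⟩
  surjective := koszulAug_surjective θ

end STheta

/-! ### Global dimension and projective resolutions -/

section Homological

open Limits

/-- Restriction of scalars along a ring isomorphism is bijective on Ext, so the same degrees vanish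
over both rings. -/
theorem HasGlobalDimension.of_ringEquiv {R S : Type u} [Ring R] [Ring S] (e : R ≃+* S) {d : ℕ}
    (h : HasGlobalDimension S d) : HasGlobalDimension R d := by
  have key : ∀ (R S : Type u) [Ring R] [Ring S] (_ : R ≃+* S) (i : ℕ),
      (∀ M N : ModuleCat.{u} R, Subsingleton (Ext M N i)) →
        ∀ M N : ModuleCat.{u} S, Subsingleton (Ext M N i) := by
    intro R S _ _ e i h M N
    have := h ((ModuleCat.restrictScalars e.toRingHom).obj M)
      ((ModuleCat.restrictScalars e.toRingHom).obj N)
    have hb := (ModuleCat.restrictScalars.{u} e.toRingHom).mapExt_bijective_of_preservesProjectiveObjects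
      M N i
    exact hb.injective.subsingleton
  have : {i : ℕ | ∀ M N : ModuleCat.{u} R, Subsingleton (Ext M N (i + 1))} =
      {i : ℕ | ∀ M N : ModuleCat.{u} S, Subsingleton (Ext M N (i + 1))} :=
    Set.ext fun i => ⟨key R S e (i + 1), key S R e.symm (i + 1)⟩
  rw [HasGlobalDimension, this]
  exact h

/-- Dimension shifting along 0 → K → P → M → 0 with P projective: Ext^i(K, N) surjects onto
Ext^{i+1}(M, N). -/
theorem subsingleton_ext_succ {R : Type u} [Ring R] {i : ℕ}
    (h : ∀ M N : ModuleCat.{u} R, Subsingleton (Ext M N i)) (M N : ModuleCat.{u} R) :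
    Subsingleton (Ext M N (i + 1)) := by
  let P : ProjectivePresentation M := Classical.arbitrary _
  have := P.projective
  let T := ShortComplex.mk _ _ (kernel.condition P.f)
  have hT : T.ShortExact := { exact := ShortComplex.exact_kernel P.f }
  refine subsingleton_of_forall_eq 0 fun y => ?_
  obtain ⟨z, rfl⟩ := Ext.contravariant_sequence_exact₃ hT N y (Ext.eq_zero_of_projective _)
    (add_comm 1 i)
  rw [(h _ _).elim z 0, Ext.comp_zero]

/-- If every module has a projective resolution that vanishes in degree `d + 1`, and some
`Ext^d` does not vanish, then the global dimension is `d`. -/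
theorem hasGlobalDimension_of_resolutions {R : Type u} [Ring R] {d : ℕ}
    (h : ∀ M : ModuleCat.{u} R, ∃ P : ProjectiveResolution M, IsZero (P.complex.X (d + 1)))
    (M N : ModuleCat.{u} R) (hMN : Nontrivial (Ext M N d)) : HasGlobalDimension R d := by
  constructor
  · intro M N
    obtain ⟨P, hP⟩ := h M
    refine subsingleton_of_forall_eq 0 fun y => ?_
    obtain ⟨f, hf, rfl⟩ := P.extMk_surjective y (d + 2) rfl
    obtain rfl := hP.eq_of_src f 0
    exact P.extMk_zero _ _
  · intro e he
    by_contra! hlt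
    -- Vanishing in degree e + 1 propagates upwards; if e < d it would reach degree d.
    have : ∀ i, ∀ M N : ModuleCat.{u} R, Subsingleton (Ext M N (e + 1 + i)) := by
      intro i
      induction i with
      | zero => exact he
      | succ i ih => exact subsingleton_ext_succ ih
    obtain ⟨i, rfl⟩ := Nat.exists_eq_add_of_lt hlt
    have h' := this i M N
    rw [show e + 1 + i = e + i + 1 by omega] at h'
    exact not_subsingleton _ h'

/-! ### Projective resolutions from exact sequences -/

section Resolution

variable {R : Type u} [Ring R] (X : ℕ → ModuleCat.{u} R) (d : ∀ m, X (m + 1) ⟶ X m)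
  (hd : ∀ m, Function.Exact (d (m + 1)).hom (d m).hom)

/-- The chain complex given by an exact sequence of modules. -/
noncomputable def complexOfExact : ChainComplex (ModuleCat.{u} R) ℕ :=
  ChainComplex.of X d fun m => by
    ext y
    exact (hd m _).2 ⟨y, rfl⟩

theorem complexOfExact_d (m : ℕ) : (complexOfExact X d hd).d (m + 1) m = d m :=
  ChainComplex.of_d X d m

variable (Z : ModuleCat.{u} R) (π : X 0 ⟶ Z) (h₀ : Function.Exact (d 0).hom π.hom)
  (hπ : Function.Surjective π.hom)

theorem d_comp_eq_zero (h₀ : Function.Exact (d 0).hom π.hom) : d 0 ≫ π = 0 := by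
  ext y
  exact (h₀ _).2 ⟨y, rfl⟩

/-- The augmentation of the chain complex given by an exact sequence of modules. -/
noncomputable def augmentationOfExact :
    complexOfExact X d hd ⟶ (ChainComplex.single₀ (ModuleCat.{u} R)).obj Z :=
  (ChainComplex.toSingle₀Equiv _ _).symm ⟨π, by
    rw [complexOfExact_d]
    exact d_comp_eq_zero X d Z π h₀⟩

theorem augmentationOfExact_f_zero : (augmentationOfExact X d hd Z π h₀).f 0 = π :=
  ChainComplex.toSingle₀Equiv_symm_apply_f_zero _ _

/-- A projective resolution from an exact sequence of projective modules. -/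
noncomputable def projectiveResolutionOfExact (hX : ∀ m, Module.Projective R (X m)) :
    ProjectiveResolution Z where
  complex := complexOfExact X d hd
  projective m := (IsProjective.iff_projective _).1 (hX m)
  π := augmentationOfExact X d hd Z π h₀
  quasiIso := ⟨fun m => by
    cases m with
    | zero =>
      rw [ChainComplex.quasiIsoAt₀_iff, ShortComplex.quasiIso_iff_of_zeros']
      · refine (ShortComplex.exact_and_epi_g_iff_of_iso
          (S₂ := ShortComplex.mk _ _ (d_comp_eq_zero X d Z π h₀)) ?_).2
          ⟨(ShortComplex.ShortExact.moduleCat_exact_iff_function_exact _).2 h₀,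
            (ModuleCat.epi_iff_surjective _).2 hπ⟩
        refine ShortComplex.isoMk (Iso.refl _) (Iso.refl _) (Iso.refl _) ?_ ?_
        · exact (Category.id_comp _).trans
            ((complexOfExact_d X d hd 0).symm.trans (Category.comp_id _).symm)
        · exact (Category.id_comp _).trans
            ((augmentationOfExact_f_zero X d hd Z π h₀).symm.trans (Category.comp_id _).symm)
      all_goals rfl
    | succ m =>
      rw [quasiIsoAt_iff_exactAt']
      · rw [HomologicalComplex.exactAt_iff' _ (m + 2) (m + 1) m (by simp) (by simp)]
        rw [ShortComplex.ShortExact.moduleCat_exact_iff_function_exact]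
        change Function.Exact ((complexOfExact X d hd).d (m + 2) (m + 1)).hom
          ((complexOfExact X d hd).d (m + 1) m).hom
        rw [complexOfExact_d, complexOfExact_d]
        exact hd m
      · apply ChainComplex.exactAt_succ_single_obj⟩

theorem projectiveResolutionOfExact_π (hX : ∀ m, Module.Projective R (X m)) :
    (projectiveResolutionOfExact X d hd Z π h₀ hπ hX).π.f 0 = π :=
  augmentationOfExact_f_zero X d hd Z π h₀

end Resolution

end Homological

namespace STheta

variable {k : Type u} [Field k] {n : ℕ} (θ : Matrix (Fin (n + 1)) (Fin (n + 1)) kˣ)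

open KoszulType TensorProduct

/-! ### Koszul resolutions of arbitrary modules -/

section Bimodule

variable {A : Type u} [Ring A] [Algebra k A] (x : Fin (n + 1) → A)
  (M : Type u) [AddCommGroup M] [Module k M]

/-- The operators `y ⊗ m ↦ (∏ θ_{ji}) x_i y ⊗ m`. -/
noncomputable def leftC (I : Finset (Fin (n + 1))) (i : Fin (n + 1)) :
    A ⊗[k] M →ₗ[Aᵐᵒᵖ] A ⊗[k] M :=
  AlgebraTensorModule.map (leftMulRight ((∏ j ∈ I, (θ j i : k)) • x i)) LinearMap.id

theorem leftC_apply (I : Finset (Fin (n + 1))) (i : Fin (n + 1)) (y : A ⊗[k] M) :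
    leftC θ x M I i y = (∏ j ∈ I, (θ j i : k)) •
      TensorProduct.map (LinearMap.mulLeft k (x i)) LinearMap.id y := by
  induction y using TensorProduct.induction_on with
  | zero => simp
  | tmul s m => simp [leftC, leftMulRight, TensorProduct.smul_tmul']
  | add y z hy hz => simp only [map_add, smul_add, hy, hz]

variable (hx : ∀ i j, (θ i j : k) • (x i * x j) = (θ j i : k) • (x j * x i))

include hx in
theorem map_mulLeft_comm (i j : Fin (n + 1)) (y : A ⊗[k] M) :
    (θ i j : k) • TensorProduct.map (LinearMap.mulLeft k (x i)) LinearMap.id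
        (TensorProduct.map (LinearMap.mulLeft k (x j)) LinearMap.id y) =
      (θ j i : k) • TensorProduct.map (LinearMap.mulLeft k (x j)) LinearMap.id
        (TensorProduct.map (LinearMap.mulLeft k (x i)) LinearMap.id y) := by
  induction y using TensorProduct.induction_on with
  | zero => simp
  | tmul s m =>
    simp only [TensorProduct.map_tmul, LinearMap.mulLeft_apply, TensorProduct.smul_tmul',
      ← mul_assoc, ← smul_mul_assoc, hx i j]
  | add y z hy hz => simp only [map_add, smul_add, hy, hz]

include hx in
theorem leftC_comm (J : Finset (Fin (n + 1))) (i j : Fin (n + 1)) (hi : i ∉ J) (hj : j ∉ J)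
    (hij : i ≠ j) (y : A ⊗[k] M) :
    leftC θ x M (insert i J) i (leftC θ x M (insert j (insert i J)) j y) =
      leftC θ x M (insert j J) j (leftC θ x M (insert i (insert j J)) i y) :=
  koszul_comm θ (fun i => TensorProduct.map (LinearMap.mulLeft k (x i)) LinearMap.id)
    (fun _ => 0) (fun I i y => leftC θ x M I i y) (fun I i y => by simp [leftC_apply])
    (map_mulLeft_comm θ x M hx) (by simp) (by simp) J i j hi hj hij y

variable (b : Module.Basis (Fin (n + 1) →₀ ℕ) k A) (c : Fin (n + 1) → (Fin (n + 1) →₀ ℕ) → kˣ)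
  (hb : ∀ i y β, b.repr (x i * y) β =
    if β i = 0 then 0 else (c i β : k) * b.repr y (β - Finsupp.single i 1))

/-- The coordinates of `A ⊗ M` in a basis of `A`. -/
noncomputable def tensorRepr : A ⊗[k] M ≃+ ((Fin (n + 1) →₀ ℕ) →₀ M) :=
  (TensorProduct.equivFinsuppOfBasisLeft b).toAddEquiv

theorem tensorRepr_tmul (s : A) (m : M) (β : Fin (n + 1) →₀ ℕ) :
    tensorRepr M b (s ⊗ₜ m) β = b.repr s β • m :=
  TensorProduct.equivFinsuppOfBasisLeft_apply_tmul_apply _ _ _ _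

include hb in
theorem tensorRepr_leftC (I : Finset (Fin (n + 1))) (i : Fin (n + 1)) (y : A ⊗[k] M)
    (β : Fin (n + 1) →₀ ℕ) : tensorRepr M b (leftC θ x M I i y) β =
      if β i = 0 then 0 else
        (((∏ j ∈ I, θ j i) * c i β : kˣ) : k) •
          tensorRepr M b y (β - Finsupp.single i 1) := by
  induction y using TensorProduct.induction_on with
  | zero => simp
  | tmul s m =>
    rw [leftC_apply, TensorProduct.map_tmul, TensorProduct.smul_tmul', tensorRepr_tmul,
      tensorRepr_tmul, map_smul, Finsupp.smul_apply, LinearMap.mulLeft_apply, hb]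
    split_ifs
    · simp
    · simp [smul_smul, mul_assoc]
  | add y z hy hz =>
    simp only [map_add, Finsupp.add_apply, hy, hz]
    split_ifs <;> simp

variable [Module Aᵐᵒᵖ M] [IsScalarTower k Aᵐᵒᵖ M]

/-- The action of `x_i` on a right module. -/
noncomputable def actX (i : Fin (n + 1)) : M →ₗ[k] M :=
  Algebra.lsmul k k M (MulOpposite.op (x i))

theorem actX_apply (i : Fin (n + 1)) (m : M) :
    actX (k := k) x M i m = MulOpposite.op (x i) • m := rfl

/-- The operators `y ⊗ m ↦ (∏ θ_{ij}) y ⊗ m x_i`. -/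
noncomputable def rightC (I : Finset (Fin (n + 1))) (i : Fin (n + 1)) :
    A ⊗[k] M →ₗ[Aᵐᵒᵖ] A ⊗[k] M :=
  AlgebraTensorModule.map LinearMap.id ((∏ j ∈ I, (θ i j : k)) • actX x M i)

/-- The components of the differential of the Koszul resolution of `M`. -/
noncomputable def bimoduleC (I : Finset (Fin (n + 1))) (i : Fin (n + 1)) :
    A ⊗[k] M →ₗ[Aᵐᵒᵖ] A ⊗[k] M :=
  leftC θ x M I i - rightC θ x M I i

theorem rightC_apply (I : Finset (Fin (n + 1))) (i : Fin (n + 1)) (y : A ⊗[k] M) :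
    rightC θ x M I i y = (∏ j ∈ I, (θ i j : k)) •
      TensorProduct.map LinearMap.id (actX x M i) y := by
  induction y using TensorProduct.induction_on with
  | zero => simp
  | tmul s m => simp [rightC]
  | add y z hy hz => simp only [map_add, smul_add, hy, hz]

include hx in
theorem map_actX_comm (i j : Fin (n + 1)) (y : A ⊗[k] M) :
    (θ j i : k) • TensorProduct.map LinearMap.id (actX x M i)
        (TensorProduct.map LinearMap.id (actX x M j) y) =
      (θ i j : k) • TensorProduct.map LinearMap.id (actX x M j)
        (TensorProduct.map LinearMap.id (actX x M i) y) := by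
  induction y using TensorProduct.induction_on with
  | zero => simp
  | tmul s m =>
    simp only [TensorProduct.map_tmul, LinearMap.id_apply, actX_apply, ← TensorProduct.tmul_smul,
      smul_smul, ← MulOpposite.op_mul]
    rw [← smul_assoc, ← smul_assoc, ← MulOpposite.op_smul, ← MulOpposite.op_smul, hx j i]
  | add y z hy hz => simp only [map_add, smul_add, hy, hz]

include hx in
theorem bimoduleC_comm (J : Finset (Fin (n + 1))) (i j : Fin (n + 1)) (hi : i ∉ J) (hj : j ∉ J)
    (hij : i ≠ j) (y : A ⊗[k] M) :
    bimoduleC θ x M (insert i J) i (bimoduleC θ x M (insert j (insert i J)) j y) =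
      bimoduleC θ x M (insert j J) j (bimoduleC θ x M (insert i (insert j J)) i y) :=
  koszul_comm θ (fun i => TensorProduct.map (LinearMap.mulLeft k (x i)) LinearMap.id)
    (fun i => TensorProduct.map LinearMap.id (actX x M i)) (fun I i y => bimoduleC θ x M I i y)
    (fun I i y => by rw [bimoduleC, LinearMap.sub_apply, leftC_apply, rightC_apply])
    (map_mulLeft_comm θ x M hx) (map_actX_comm θ x M hx)
    (fun i j y => by
      induction y using TensorProduct.induction_on with
      | zero => simp
      | tmul s m => simp
      | add y z hy hz => simp only [map_add, hy, hz]) J i j hi hj hij y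

theorem tensorRepr_rightC (I : Finset (Fin (n + 1))) (i : Fin (n + 1)) (y : A ⊗[k] M)
    (β : Fin (n + 1) →₀ ℕ) : tensorRepr M b (rightC θ x M I i y) β =
      ((∏ j ∈ I, (θ i j : k)) • actX (k := k) x M i) (tensorRepr M b y β) := by
  induction y using TensorProduct.induction_on with
  | zero => simp
  | tmul s m =>
    rw [rightC, AlgebraTensorModule.map_tmul, tensorRepr_tmul, tensorRepr_tmul, map_smul]
    rfl
  | add y z hy hz => simp only [map_add, Finsupp.add_apply, hy, hz]

-- In coordinates with respect to a basis of `A`, `leftC` shifts exponents, while `rightC` acts only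
-- on the factor `M` and leaves them fixed. So `rightC` is a perturbation of the kind allowed in
-- `d_sub_exact`.
include hx hb in
theorem bimoduleC_exact (f : Finset (Fin (n + 1)) → A ⊗[k] M)
    (hf : d (bimoduleC θ x M) f = 0) : ∃ g, ∀ J β, (J ≠ ∅ ∨ β ≠ 0) →
      tensorRepr M b (f J) β = tensorRepr M b (d (bimoduleC θ x M) g J) β :=
  d_sub_exact (bimoduleC θ x M) (leftC θ x M) (bimoduleC_comm θ x M hx) (leftC_comm θ x M hx)
    (tensorRepr M b) _ (tensorRepr_leftC θ x M b c hb) (by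
      intro I i y β h
      rw [bimoduleC, LinearMap.sub_apply, map_sub, Finsupp.sub_apply, tensorRepr_rightC, h,
        map_zero, sub_zero]) f hf

/-- The right action `A ⊗ M → M`. -/
noncomputable def actionMap : A ⊗[k] M →ₗ[Aᵐᵒᵖ] M :=
  AlgebraTensorModule.lift
    { toFun := fun s => Algebra.lsmul k k M (MulOpposite.op s)
      map_add' := fun s t => by rw [MulOpposite.op_add, map_add]
      map_smul' := fun r s => by
        ext m
        simp }

theorem actionMap_tmul (s : A) (m : M) :
    actionMap (k := k) M (s ⊗ₜ m) = MulOpposite.op s • m := rfl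

/-- For I = {i} both coefficients are θ_ii, and m(x_i y) = (m x_i)y. -/
theorem actionMap_bimoduleC (i : Fin (n + 1)) (y : A ⊗[k] M) :
    actionMap M (bimoduleC θ x M {i} i y) = 0 := by
  rw [bimoduleC, LinearMap.sub_apply, map_sub, sub_eq_zero]
  induction y using TensorProduct.induction_on with
  | zero => simp
  | tmul s m =>
    simp only [leftC_apply, rightC_apply, TensorProduct.map_tmul, LinearMap.mulLeft_apply,
      LinearMap.id_apply, Finset.prod_singleton, actX_apply]
    rw [TensorProduct.smul_tmul', ← TensorProduct.tmul_smul, actionMap_tmul, actionMap_tmul,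
      MulOpposite.op_smul, smul_assoc, smul_comm (MulOpposite.op s), MulOpposite.op_mul, mul_smul]
  | add y z hy hz => simp only [map_add, hy, hz]

/-- The augmentation of the Koszul resolution of `M`. -/
noncomputable def bimoduleAug : (Subsets n 0 → A ⊗[k] M) →ₗ[Aᵐᵒᵖ] M :=
  actionMap M ∘ₗ LinearMap.proj ⟨∅, rfl⟩

theorem bimoduleAug_dSub (g : Subsets n 1 → A ⊗[k] M) :
    bimoduleAug M (dSub (bimoduleC θ x M) 0 g) = 0 := by
  change actionMap M (dSub (bimoduleC θ x M) 0 g ⟨∅, rfl⟩) = 0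
  rw [dSub_apply, d_apply, map_sum, Finset.sum_eq_zero]
  intro i _
  rw [map_zsmul]
  simp only [insert_empty_eq]
  rw [actionMap_bimoduleC, smul_zero]

variable (hb₁ : b.repr 1 = Finsupp.single 0 1)

-- Modulo boundaries an element has the form 1 ⊗ r, because 1 is the basis vector of exponent 0, and
-- the action map sends 1 ⊗ r to r.
include hx hb hb₁ in
theorem bimoduleAug_exact :
    Function.Exact (dSub (bimoduleC θ x M) 0) (bimoduleAug (k := k) (n := n) M) := by
  intro f
  constructor
  · intro hf
    obtain ⟨g, r, hg⟩ := exists_sub_dSub_eq (tensorRepr M b) (bimoduleC_exact θ x M hx b c hb) f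
    have hr : (tensorRepr M b).symm (Finsupp.single 0 r) = 1 ⊗ₜ r := by
      rw [AddEquiv.symm_apply_eq]
      ext β
      rw [tensorRepr_tmul, hb₁]
      by_cases hβ : β = 0
      · simp [hβ]
      · simp [Finsupp.single_eq_of_ne hβ]
    rw [hr] at hg
    have h := congrArg (bimoduleAug M) hg
    rw [map_sub, hf, bimoduleAug_dSub, sub_zero] at h
    have h₁ : r = 0 := by
      refine Eq.trans ?_ h.symm
      change r = actionMap (A := A) (k := k) M (1 ⊗ₜ r)
      rw [actionMap_tmul, MulOpposite.op_one, one_smul]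
    refine ⟨g, (sub_eq_zero.1 (hg.trans ?_)).symm⟩
    rw [h₁, TensorProduct.tmul_zero]
    rfl
  · rintro ⟨g, rfl⟩
    exact bimoduleAug_dSub θ x M g

theorem bimoduleAug_surjective :
    Function.Surjective (bimoduleAug (A := A) (k := k) (n := n) M) := fun m =>
  ⟨fun _ => 1 ⊗ₜ m, by
    change actionMap (A := A) (k := k) M (1 ⊗ₜ m) = m
    rw [actionMap_tmul, MulOpposite.op_one, one_smul]⟩

include hx hb in
theorem dSub_bimoduleC_exact (m : ℕ) :
    Function.Exact (dSub (bimoduleC θ x M) (m + 1)) (dSub (bimoduleC θ x M) m) := by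
  intro f
  constructor
  · exact exists_dSub_eq (tensorRepr M b) (bimoduleC_exact θ x M hx b c hb) f
  · rintro ⟨g, rfl⟩
    exact dSub_dSub _ (bimoduleC_comm θ x M hx) g

end Bimodule

instance isEmpty_subsets : IsEmpty (Subsets n (n + 2)) := ⟨fun I => by
  have := I.1.card_le_univ
  rw [I.2, Fintype.card_fin] at this
  omega⟩

theorem projective_fun (R ι X : Type*) [Ring R] [AddCommGroup X] [Module R X] [Fintype ι]
    [DecidableEq ι] [Module.Projective R X] : Module.Projective R (ι → X) :=
  Module.Projective.of_equiv (DFinsupp.linearEquivFunOnFintype (R := R) (M := fun _ : ι => X))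

/-- This is M tensored with a Koszul bimodule resolution of `A`, the factors being written in the
opposite order. `A` acts from the right on the factor `A` alone, so the terms are projective; there
are no subsets of size n + 2. -/
theorem exists_resolution_of_basis {A : Type u} [Ring A] [Algebra k A] (x : Fin (n + 1) → A)
    (hx : ∀ i j, (θ i j : k) • (x i * x j) = (θ j i : k) • (x j * x i))
    (b : Module.Basis (Fin (n + 1) →₀ ℕ) k A) (c : Fin (n + 1) → (Fin (n + 1) →₀ ℕ) → kˣ)
    (hb : ∀ i y β, b.repr (x i * y) β =
      if β i = 0 then 0 else (c i β : k) * b.repr y (β - Finsupp.single i 1))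
    (hb₁ : b.repr 1 = Finsupp.single 0 1) (M : ModuleCat.{u} Aᵐᵒᵖ) :
    ∃ P : ProjectiveResolution M, Limits.IsZero (P.complex.X (n + 2)) := by
  let _ : Module k M := Module.compHom M (algebraMap k Aᵐᵒᵖ)
  have _ : IsScalarTower k Aᵐᵒᵖ M := ⟨fun c r m => by
    rw [Algebra.smul_def, mul_smul]
    rfl⟩
  have _ : Module.Projective Aᵐᵒᵖ A :=
    Module.Projective.of_equiv (MulOpposite.opLinearEquiv Aᵐᵒᵖ).symm
  have _ : Module.Projective Aᵐᵒᵖ (A ⊗[k] M) := inferInstance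
  refine ⟨projectiveResolutionOfExact
    (fun m => ModuleCat.of Aᵐᵒᵖ (Subsets n m → A ⊗[k] M))
    (fun m => ModuleCat.ofHom (dSub (bimoduleC θ x M) m)) (dSub_bimoduleC_exact θ x M hx b c hb) M
    (ModuleCat.ofHom (bimoduleAug M)) (bimoduleAug_exact θ x M hx b c hb hb₁)
    (bimoduleAug_surjective M) 
    (fun m => projective_fun Aᵐᵒᵖ (Subsets n m) (A ⊗[k] M)), ?_⟩
  change Limits.IsZero (ModuleCat.of Aᵐᵒᵖ (Subsets n (n + 2) → A ⊗[k] M))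
  exact ModuleCat.isZero_of_subsingleton _

theorem repr_x_mul (i : Fin (n + 1)) (y : STheta θ) (β : Fin (n + 1) →₀ ℕ) :
    (basis θ).repr (x θ i * y) β = if β i = 0 then 0 else
      (stepCoeff θ i (β - Finsupp.single i 1) : k) *
        (basis θ).repr y (β - Finsupp.single i 1) := by
  simpa [koszulC_apply] using repr_koszulC θ ∅ i y β

theorem repr_one : (basis θ).repr 1 = Finsupp.single 0 1 := by
  rw [← mono_zero, ← basis_apply, Module.Basis.repr_self]

theorem exists_resolution (M : ModuleCat.{u} (STheta θ)ᵐᵒᵖ) :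
    ∃ P : ProjectiveResolution M, Limits.IsZero (P.complex.X (n + 2)) :=
  exists_resolution_of_basis θ (x θ) (x_comm θ) (basis θ) _ (repr_x_mul θ) (repr_one θ) M

end STheta

namespace STheta

variable {k : Type u} [Field k] {n : ℕ} (θ : Matrix (Fin (n + 1)) (Fin (n + 1)) kˣ)

open KoszulType

/-! ### The Koszul complex as a projective resolution -/

instance projective_self (A : Type*) [Ring A] : Module.Projective Aᵐᵒᵖ A :=
  Module.Projective.of_equiv (MulOpposite.opLinearEquiv Aᵐᵒᵖ).symm

theorem koszulD_function_exact (m : ℕ) :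
    Function.Exact (koszulD θ (m + 1)) (koszulD θ m) := fun f =>
  ⟨koszulD_exact θ m f, by rintro ⟨g, rfl⟩; exact koszulD_d θ m g⟩

theorem koszulAug_function_exact : Function.Exact (koszulD θ 0) (koszulAug θ) := fun f =>
  ⟨koszulAug_exact θ f, by rintro ⟨g, rfl⟩; exact koszulAug_koszulD θ g⟩

/-- The augmentation of the Koszul complex, as a morphism. -/
noncomputable def koszulAugHom :
    ModuleCat.of (STheta θ)ᵐᵒᵖ (Koszul θ 0) ⟶ trivialRight (aug θ) :=
  (ModuleCat.ofHom (X := Koszul θ 0) (Y := trivialRight (aug θ)) (koszulAug θ) :)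

/-- The Koszul resolution of the right module `k`. -/
noncomputable def koszulResolution : ProjectiveResolution (trivialRight (aug θ)) :=
  projectiveResolutionOfExact (fun m => ModuleCat.of (STheta θ)ᵐᵒᵖ (Koszul θ m))
    (fun m => ModuleCat.ofHom (koszulD θ m)) (koszulD_function_exact θ) _ (koszulAugHom θ)
    (koszulAug_function_exact θ) (koszulAug_surjective θ)
    (fun m => projective_fun (STheta θ)ᵐᵒᵖ (Subsets n m) (STheta θ))

theorem koszulResolution_d (m : ℕ) :
    (koszulResolution θ).complex.d (m + 1) m = ModuleCat.ofHom (koszulD θ m) :=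
  complexOfExact_d _ _ (koszulD_function_exact θ) m

theorem koszulResolution_π : (koszulResolution θ).π.f 0 = koszulAugHom θ :=
  projectiveResolutionOfExact_π (fun m => ModuleCat.of (STheta θ)ᵐᵒᵖ (Koszul θ m))
    (fun m => ModuleCat.ofHom (koszulD θ m)) (koszulD_function_exact θ) _ (koszulAugHom θ)
    (koszulAug_function_exact θ) (koszulAug_surjective θ)
    (fun m => projective_fun (STheta θ)ᵐᵒᵖ (Subsets n m) (STheta θ))

/-- The coefficient of `e_{I \ {i}}` in the differential of `e_I`. -/
noncomputable def koszulCoeff (I : Finset (Fin (n + 1))) (i : Fin (n + 1)) : STheta θ :=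
  ((-1 : k) ^ (I.filter (· < i)).card * ∏ j ∈ I, (θ j i : k)) • x θ i

theorem koszulD_single {m : ℕ} (I : Subsets n (m + 1)) :
    koszulD θ m (Pi.single I 1) =
      ∑ i : I.1, Pi.single (I.erase i) (koszulCoeff θ I.1 i.1) := by
  rw [koszulD, LinearMap.sum_apply, Finset.sum_eq_single I]
  · rw [LinearMap.sum_apply]
    refine Finset.sum_congr rfl fun i _ => ?_
    simp only [LinearMap.comp_apply, LinearMap.proj_apply, Pi.single_eq_same]
    exact congrArg _ (mul_one _)
  · intro I' _ h
    rw [LinearMap.sum_apply, Finset.sum_eq_zero]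
    intro i _
    simp only [LinearMap.comp_apply, LinearMap.proj_apply, Pi.single_eq_of_ne h, map_zero]
  · simp

/-! ### Homomorphisms out of the free Koszul terms -/

section Lift

variable {Y : Type*} [AddCommGroup Y] [Module (STheta θ)ᵐᵒᵖ Y]

/-- The homomorphism out of a term of the Koszul complex with given values on the generators. -/
noncomputable def koszulLift {m : ℕ} (y : Subsets n m → Y) : Koszul θ m →ₗ[(STheta θ)ᵐᵒᵖ] Y where
  toFun v := ∑ I, MulOpposite.op (v I) • y I
  map_add' v w := by
    rw [← Finset.sum_add_distrib]
    exact Finset.sum_congr rfl fun I _ => by rw [Pi.add_apply, MulOpposite.op_add, add_smul]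
  map_smul' r v := by
    rw [RingHom.id_apply, Finset.smul_sum]
    exact Finset.sum_congr rfl fun I _ => (mul_smul r (MulOpposite.op (v I)) (y I))

theorem koszulLift_single {m : ℕ} (y : Subsets n m → Y) (I : Subsets n m) (s : STheta θ) :
    koszulLift θ y (Pi.single I s) = MulOpposite.op s • y I := by
  change ∑ I', MulOpposite.op ((Pi.single I s : Koszul θ m) I') • y I' = _
  rw [Finset.sum_eq_single I]
  · rw [Pi.single_eq_same]
  · intro I' _ h
    rw [Pi.single_eq_of_ne h, MulOpposite.op_zero, zero_smul]
  · simp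

theorem apply_single {m : ℕ} (g : Koszul θ m →ₗ[(STheta θ)ᵐᵒᵖ] Y) (I : Subsets n m)
    (s : STheta θ) : g (Pi.single I s) = MulOpposite.op s • g (Pi.single I 1) := by
  rw [← map_smul]
  congr 1
  funext I'
  rw [Pi.smul_apply]
  by_cases h : I' = I
  · subst h
    simp
  · simp [Pi.single_eq_of_ne h]

theorem koszul_hom_ext {m : ℕ} {g g' : Koszul θ m →ₗ[(STheta θ)ᵐᵒᵖ] Y}
    (h : ∀ I, g (Pi.single I 1) = g' (Pi.single I 1)) : g = g' := by
  refine LinearMap.pi_ext fun I s => ?_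
  rw [apply_single, apply_single θ g', h]

theorem apply_koszulD_single {m : ℕ} (g : Koszul θ m →ₗ[(STheta θ)ᵐᵒᵖ] Y)
    (I : Subsets n (m + 1)) : g (koszulD θ m (Pi.single I 1)) =
      ∑ i : I.1, MulOpposite.op (koszulCoeff θ I.1 i.1) • g (Pi.single (I.erase i) 1) := by
  rw [koszulD_single, map_sum]
  exact Finset.sum_congr rfl fun i _ => apply_single θ g _ _

end Lift

/-! ### The dual of the Koszul complex -/

/-- The components of the dual of the Koszul differential, for the sets of indices replaced by
their complements. -/
noncomputable def dualC (I : Finset (Fin (n + 1))) (i : Fin (n + 1)) :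
    STheta θ →ₗ[k] STheta θ :=
  ((-1 : k) ^ (i : ℕ) * ∏ l ∈ insert i Iᶜ, (θ l i : k)) • LinearMap.mulRight k (x θ i)

theorem dualC_apply (I : Finset (Fin (n + 1))) (i : Fin (n + 1)) (y : STheta θ) :
    dualC θ I i y = ((-1 : k) ^ (i : ℕ) * ∏ l ∈ insert i Iᶜ, (θ l i : k)) • (y * x θ i) := rfl

theorem dualC_comm (J : Finset (Fin (n + 1))) (i j : Fin (n + 1)) (hi : i ∉ J) (hj : j ∉ J)
    (hij : i ≠ j) (y : STheta θ) :
    dualC θ (insert i J) i (dualC θ (insert j (insert i J)) j y) =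
      dualC θ (insert j J) j (dualC θ (insert i (insert j J)) i y) := by
  have e₁ : ∀ i ∉ J, insert i (insert i J)ᶜ = Jᶜ := by
    intro i hi
    rw [Finset.compl_insert, Finset.insert_erase (Finset.mem_compl.2 hi)]
  have e₂ : ∀ i ∉ J, ∀ j ∉ J, i ≠ j → insert j (insert j (insert i J))ᶜ = Jᶜ.erase i := by
    intro i hi j hj hij
    rw [Finset.compl_insert, Finset.insert_erase, Finset.compl_insert]
    simp [hj, hij.symm]
  have e₃ : ∀ i ∉ J, ∀ j, θ i j * ∏ l ∈ Jᶜ.erase i, (θ l j : k) = ∏ l ∈ Jᶜ, (θ l j : k) :=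
    fun i hi j => Finset.mul_prod_erase Jᶜ (fun l => (θ l j : k)) (Finset.mem_compl.2 hi)
  simp only [dualC_apply, smul_mul_assoc, smul_smul, e₁ i hi, e₁ j hj, e₂ i hi j hj hij,
    e₂ j hj i hi hij.symm, mul_assoc]
  rw [← e₃ j hj i, ← e₃ i hi j]
  have h := congrArg (fun z => ((-1 : k) ^ (i : ℕ) * (-1 : k) ^ (j : ℕ) *
    (∏ l ∈ Jᶜ.erase j, (θ l i : k)) * ∏ l ∈ Jᶜ.erase i, (θ l j : k)) • (y * z)) (x_comm θ j i)
  simp only [mul_smul_comm, smul_smul] at h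
  convert h using 2 <;> ring

/-- Exactly i indices are smaller than i, divided between I and its complement. So the signs of I
and of its complement differ by (-1)^i, the twist built into `dualC`. -/
theorem sign_compl (I : Finset (Fin (n + 1))) (i : Fin (n + 1)) :
    (sign (insert i Iᶜ) i : k) * (-1 : k) ^ (i : ℕ) = (-1 : k) ^ (I.filter (· < i)).card := by
  have h : (I.filter (· < i)).card + (Iᶜ.filter (· < i)).card = (i : ℕ) := by
    rw [← Finset.card_union_of_disjoint, ← Finset.filter_union, Finset.union_compl]
    · simp [Finset.filter_gt_eq_Iio]
    · exact Finset.disjoint_filter_filter disjoint_compl_right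
  simp only [sign, Finset.filter_insert, lt_irrefl, if_false, ← h, pow_add]
  push_cast
  rw [mul_left_comm, ← mul_pow]
  simp

/-- The right side is the value on e_I of the coboundary of the cochain F. Removing i from I adds it
to the complement, so after complementation the dual complex is again of Koszul type. -/
theorem d_dualC (F : Finset (Fin (n + 1)) → STheta θ) (I : Finset (Fin (n + 1))) :
    d (dualC θ) (fun J => F Jᶜ) Iᶜ = ∑ i ∈ I, F (I.erase i) * koszulCoeff θ I i := by
  rw [d_apply, compl_compl]
  refine Finset.sum_congr rfl fun i hi => ?_
  rw [dualC_apply, koszulCoeff, ← Int.cast_smul_eq_zsmul k, smul_smul, ← mul_assoc, sign_compl,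
    Finset.compl_insert, compl_compl, Finset.insert_erase hi, mul_smul_comm]

theorem exists_repr_mul_x : ∃ c : Fin (n + 1) → (Fin (n + 1) →₀ ℕ) → kˣ,
    ∀ i y β, (basis θ).repr (y * x θ i) β = if β i = 0 then 0 else
      (c i β : k) * (basis θ).repr y (β - Finsupp.single i 1) := by
  choose c hc using fun (i : Fin (n + 1)) α =>
    exists_mono_mul_mono θ α (Finsupp.single i 1)
  refine ⟨fun i β => c i (β - Finsupp.single i 1), fun i y β => ?_⟩
  have := repr_apply_of_shift θ (Finsupp.single i 1) (LinearMap.mulRight k (x θ i))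
    (fun β => c i β) (fun α => by rw [LinearMap.mulRight_apply, x_eq_mono, hc]) y β
  rw [LinearMap.mulRight_apply] at this
  rw [this]
  simp only [Finsupp.single_le_iff, Nat.one_le_iff_ne_zero, ite_not]

/-- The exceptional place J = ∅, β = 0 becomes the full index set, so cohomology remains only in the
top degree. -/
theorem dualC_exact (F : Finset (Fin (n + 1)) → STheta θ)
    (hF : ∀ I, ∑ i ∈ I, F (I.erase i) * koszulCoeff θ I i = 0) :
    ∃ G : Finset (Fin (n + 1)) → STheta θ, ∀ I β, (I ≠ Finset.univ ∨ β ≠ 0) →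
      (basis θ).repr (F I) β =
        (basis θ).repr (∑ i ∈ I, G (I.erase i) * koszulCoeff θ I i) β := by
  obtain ⟨c, hc⟩ := exists_repr_mul_x θ
  obtain ⟨g, -, hg⟩ := d_exact (dualC θ) (dualC_comm θ) (basis θ).repr.toAddEquiv
    (fun I i β => (-1) ^ (i : ℕ) * (∏ l ∈ insert i Iᶜ, θ l i) * c i β)
    (by
      intro I i y β
      change (basis θ).repr (dualC θ I i y) β = if β i = 0 then 0 else
        _ • (basis θ).repr y (β - Finsupp.single i 1)
      rw [dualC_apply, map_smul, Finsupp.smul_apply, hc]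
      split_ifs
      · simp
      · simp [mul_assoc])
    (fun J => F Jᶜ) (by
      funext J
      rw [← compl_compl J, d_dualC, hF]
      rfl)
  refine ⟨fun I => g Iᶜ, fun I β h => ?_⟩
  have h' := hg Iᶜ β (by rwa [ne_eq, Finset.compl_eq_empty_iff])
  simp only [compl_compl] at h'
  rw [← d_dualC θ (fun I => g Iᶜ)]
  simp only [compl_compl]
  exact h'

/-- The exactness of the dual of the Koszul complex in the degrees other than `n + 1`, and the
description of its top cohomology. -/
theorem exists_comp_koszulD {m : ℕ} (f : Koszul θ m →ₗ[(STheta θ)ᵐᵒᵖ] STheta θ)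
    (hf : f ∘ₗ koszulD θ m = 0) :
    ∃ G : Finset (Fin (n + 1)) → STheta θ, ∀ (I : Subsets n m) (β : Fin (n + 1) →₀ ℕ),
      (m ≠ n + 1 ∨ β ≠ 0) → (basis θ).repr (f (Pi.single I 1)) β =
        (basis θ).repr (∑ i ∈ I.1, G (I.1.erase i) * koszulCoeff θ I.1 i) β := by
  obtain ⟨G, hG⟩ := dualC_exact θ (extend fun I => f (Pi.single I 1)) (by
    intro I
    by_cases h : I.card = m + 1
    · have := LinearMap.congr_fun hf (Pi.single ⟨I, h⟩ 1)
      rw [LinearMap.comp_apply, apply_koszulD_single] at this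
      rw [← Finset.sum_coe_sort]
      refine Eq.trans (Finset.sum_congr rfl fun i _ => ?_) this
      rw [← extend_coe (fun I => f (Pi.single I 1))]
      rfl
    · refine Finset.sum_eq_zero fun i hi => ?_
      rw [extend_of_ne, zero_mul]
      have := Finset.card_erase_add_one hi
      omega)
  refine ⟨G, fun I β h => ?_⟩
  rw [← hG I.1 β (h.imp_left fun hm hI => hm ?_), extend_coe (fun I => f (Pi.single I 1))]
  rw [← I.2, hI, Finset.card_univ, Fintype.card_fin]

end STheta

namespace STheta

variable {k : Type u} [Field k] {n : ℕ} (θ : Matrix (Fin (n + 1)) (Fin (n + 1)) kˣ)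

open KoszulType

/-! ### The groups `Ext^i(k, S_θ)` -/

/-- The morphism from a term of the Koszul resolution given by a linear map. -/
noncomputable def homOfLinearMap {m : ℕ} (g : Koszul θ m →ₗ[(STheta θ)ᵐᵒᵖ] STheta θ) :
    (koszulResolution θ).complex.X m ⟶ rightRegular (STheta θ) :=
  (ModuleCat.ofHom g :)

/-- The linear map underlying a morphism from a term of the Koszul resolution. -/
noncomputable def linearMapOfHom {m : ℕ}
    (f : (koszulResolution θ).complex.X m ⟶ rightRegular (STheta θ)) :
    Koszul θ m →ₗ[(STheta θ)ᵐᵒᵖ] STheta θ := f.hom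

theorem linearMapOfHom_injective {m : ℕ} :
    Function.Injective (linearMapOfHom θ (m := m)) := fun _ _ h => ModuleCat.hom_ext h

theorem linearMapOfHom_d_comp {m : ℕ}
    (f : (koszulResolution θ).complex.X m ⟶ rightRegular (STheta θ)) :
    linearMapOfHom θ ((koszulResolution θ).complex.d (m + 1) m ≫ f) =
      linearMapOfHom θ f ∘ₗ koszulD θ m := by
  rw [koszulResolution_d]
  rfl

theorem linearMapOfHom_comp_eq_zero {m : ℕ}
    {f : (koszulResolution θ).complex.X m ⟶ rightRegular (STheta θ)}
    (hf : (koszulResolution θ).complex.d (m + 1) m ≫ f = 0) :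
    linearMapOfHom θ f ∘ₗ koszulD θ m = 0 := by
  rw [← linearMapOfHom_d_comp, hf]
  rfl

theorem koszulLift_comp_koszulD_single {m : ℕ} (G : Finset (Fin (n + 1)) → STheta θ)
    (I : Subsets n (m + 1)) :
    (koszulLift (Y := STheta θ) θ (fun I : Subsets n m => G I.1) ∘ₗ koszulD θ m) (Pi.single I 1) =
      ∑ i ∈ I.1, G (I.1.erase i) * koszulCoeff θ I.1 i := by
  rw [LinearMap.comp_apply, apply_koszulD_single]
  refine Eq.trans (Finset.sum_congr rfl fun i _ => ?_)
    (Finset.sum_coe_sort I.1 fun i => G (I.1.erase i) * koszulCoeff θ I.1 i)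
  rw [koszulLift_single, MulOpposite.op_one, one_smul]
  rfl

theorem ext_eq_zero {m : ℕ} (hm : m ≠ n + 1)
    (e : Ext (trivialRight (aug θ)) (rightRegular (STheta θ)) m) : e = 0 := by
  obtain ⟨f, hf, rfl⟩ := (koszulResolution θ).extMk_surjective e (m + 1) rfl
  obtain ⟨G, hG⟩ := exists_comp_koszulD θ (linearMapOfHom θ f) (linearMapOfHom_comp_eq_zero θ hf)
  have hG' : ∀ I : Subsets n m, linearMapOfHom θ f (Pi.single I 1) =
      ∑ i ∈ I.1, G (I.1.erase i) * koszulCoeff θ I.1 i := by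
    intro I
    apply (basis θ).repr.injective
    ext β
    exact hG I β (Or.inl hm)
  cases m with
  -- In degree 0 there is nothing to bound by: the sum over I = ∅ is empty, so the cocycle itself
  -- vanishes.
  | zero =>
    have : f = 0 := by
      apply linearMapOfHom_injective
      apply koszul_hom_ext
      intro I
      rw [hG', Finset.card_eq_zero.1 I.2]
      rfl
    subst this
    exact (koszulResolution θ).extMk_zero _ _
  | succ m =>
    rw [(koszulResolution θ).extMk_eq_zero_iff _ _ _ _ m rfl]
    refine ⟨homOfLinearMap θ (koszulLift θ fun I : Subsets n m => G I.1), ?_⟩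
    apply linearMapOfHom_injective
    apply koszul_hom_ext
    intro I
    rw [linearMapOfHom_d_comp, hG']
    exact koszulLift_comp_koszulD_single θ G I

/-- The full set of indices. -/
def topSubset (n : ℕ) : Subsets n (n + 1) := ⟨Finset.univ, by simp⟩

theorem eq_topSubset (I : Subsets n (n + 1)) : I = topSubset n :=
  Subtype.ext ((Finset.card_eq_iff_eq_univ _).1 (by rw [I.2, Fintype.card_fin]))

theorem d_comp_top (f : (koszulResolution θ).complex.X (n + 1) ⟶ rightRegular (STheta θ)) :
    (koszulResolution θ).complex.d (n + 1 + 1) (n + 1) ≫ f = 0 := by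
  apply linearMapOfHom_injective
  apply koszul_hom_ext
  intro I
  exact isEmptyElim I

/-- The value of a cocycle on the generator of the top term of the Koszul resolution. -/
noncomputable def topValue
    (f : (koszulResolution θ).complex.X (n + 1) ⟶ rightRegular (STheta θ)) : STheta θ :=
  linearMapOfHom θ f (Pi.single (topSubset n) 1)

theorem aug_sum_mul_koszulCoeff (G : Finset (Fin (n + 1)) → STheta θ)
    (I : Finset (Fin (n + 1))) :
    aug θ (∑ i ∈ I, G (I.erase i) * koszulCoeff θ I i) = 0 := by
  rw [map_sum, Finset.sum_eq_zero]
  intro i _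
  rw [map_mul, koszulCoeff, map_smul, aug_x, smul_zero, mul_zero]

/-- On the top generator a coboundary takes a value in the left ideal generated by the x_i, which is
the kernel of the augmentation. -/
theorem extMk_top_eq_zero_iff
    (f : (koszulResolution θ).complex.X (n + 1) ⟶ rightRegular (STheta θ)) :
    (koszulResolution θ).extMk f (n + 1 + 1) rfl (d_comp_top θ f) = 0 ↔
      aug θ (topValue θ f) = 0 := by
  rw [(koszulResolution θ).extMk_eq_zero_iff _ _ _ _ n rfl]
  constructor
  · rintro ⟨g, rfl⟩
    rw [topValue, linearMapOfHom_d_comp, LinearMap.comp_apply, apply_koszulD_single, map_sum,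
      Finset.sum_eq_zero]
    intro i _
    change aug θ (_ * koszulCoeff θ _ _) = 0
    rw [map_mul, koszulCoeff, map_smul, aug_x, smul_zero, mul_zero]
  · intro h
    obtain ⟨G, hG⟩ := exists_comp_koszulD θ (linearMapOfHom θ f)
      (linearMapOfHom_comp_eq_zero θ (d_comp_top θ f))
    refine ⟨homOfLinearMap θ (koszulLift θ fun I : Subsets n n => G I.1), ?_⟩
    apply linearMapOfHom_injective
    apply koszul_hom_ext
    intro I
    rw [linearMapOfHom_d_comp]
    refine (koszulLift_comp_koszulD_single θ G I).trans (Eq.symm ?_)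
    set s := linearMapOfHom θ f (Pi.single I 1) with hs
    set t := ∑ i ∈ I.1, G (I.1.erase i) * koszulCoeff θ I.1 i with ht
    -- The value `s` of the cocycle and the coboundary `t` agree at all nonzero exponents, so they
    -- differ by a scalar, which the augmentation detects.
    have hc : s - t = algebraMap k _ ((basis θ).repr (s - t) 0) := by
      apply (basis θ).repr.injective
      ext β
      rw [Algebra.algebraMap_eq_smul_one, map_smul, repr_one]
      by_cases hβ : β = 0
      · simp [hβ]
      · rw [map_sub, Finsupp.sub_apply, hG I β (Or.inr hβ), ← ht]
        simp [Finsupp.single_eq_of_ne hβ]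
    have h₀ := congrArg (aug θ) hc
    have hs₀ : aug θ s = 0 := by rw [hs, eq_topSubset I]; exact h
    have ht₀ : aug θ t = 0 := aug_sum_mul_koszulCoeff θ G I.1
    rw [map_sub, hs₀, ht₀, sub_zero, AlgHom.commutes] at h₀
    rw [← sub_eq_zero, hc]
    simp only [Algebra.algebraMap_self, RingHom.id_apply] at h₀
    rw [← h₀, map_zero]

/-- The class in `Ext^{n+1}(k, S_θ)` of the cocycle that maps the generator to `c`. -/
noncomputable def extTop : k →+ Ext (trivialRight (aug θ)) (rightRegular (STheta θ)) (n + 1) where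
  toFun c := (koszulResolution θ).extMk
    (homOfLinearMap θ (koszulLift θ fun _ => algebraMap k _ c)) (n + 1 + 1) rfl (d_comp_top θ _)
  map_zero' := by
    rw [extMk_top_eq_zero_iff]
    change aug θ (koszulLift (Y := STheta θ) θ _ _) = 0
    rw [koszulLift_single, map_zero, smul_zero, map_zero]
  map_add' c c' := by
    rw [ProjectiveResolution.add_extMk]
    congr 1
    apply linearMapOfHom_injective
    apply koszul_hom_ext
    intro I
    change koszulLift (Y := STheta θ) θ _ _ =
      koszulLift (Y := STheta θ) θ _ _ + koszulLift (Y := STheta θ) θ _ _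
    rw [koszulLift_single, koszulLift_single, koszulLift_single, map_add, smul_add]

theorem topValue_const (c : k) : topValue θ
    (homOfLinearMap θ (koszulLift θ fun _ : Subsets n (n + 1) => algebraMap k (STheta θ) c)) =
      algebraMap k _ c := by
  change koszulLift (Y := STheta θ) θ _ _ = _
  rw [koszulLift_single, MulOpposite.op_one, one_smul]

theorem topValue_sub (f g : (koszulResolution θ).complex.X (n + 1) ⟶ rightRegular (STheta θ)) :
    topValue θ (f - g) = topValue θ f - topValue θ g := rfl

theorem extTop_aug_topValue
    (f : (koszulResolution θ).complex.X (n + 1) ⟶ rightRegular (STheta θ)) :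
    extTop θ (aug θ (topValue θ f)) =
      (koszulResolution θ).extMk f (n + 1 + 1) rfl (d_comp_top θ f) := by
  symm
  rw [← sub_eq_zero, extTop, AddMonoidHom.coe_mk, ZeroHom.coe_mk,
    ProjectiveResolution.sub_extMk, extMk_top_eq_zero_iff]
  rw [topValue_sub, topValue_const, map_sub, AlgHom.commutes]
  exact sub_self _

theorem extTop_bijective : Function.Bijective (extTop θ) := by
  constructor
  · rw [injective_iff_map_eq_zero]
    intro c hc
    rw [extTop, AddMonoidHom.coe_mk, ZeroHom.coe_mk, extMk_top_eq_zero_iff, topValue_const,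
      AlgHom.commutes] at hc
    exact hc
  · intro e
    obtain ⟨f, hf, rfl⟩ := (koszulResolution θ).extMk_surjective e (n + 1 + 1) rfl
    exact ⟨_, extTop_aug_topValue θ f⟩

/-- The isomorphism `Ext^{n+1}(k, S_θ) ≅ k`. -/
noncomputable def extEquiv :
    Ext (trivialRight (aug θ)) (rightRegular (STheta θ)) (n + 1) ≃+ k :=
  (AddEquiv.ofBijective (extTop θ) (extTop_bijective θ)).symm

theorem extEquiv_extMk
    (f : (koszulResolution θ).complex.X (n + 1) ⟶ rightRegular (STheta θ)) :
    extEquiv θ ((koszulResolution θ).extMk f (n + 1 + 1) rfl (d_comp_top θ f)) =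
      aug θ (topValue θ f) := by
  rw [← extTop_aug_topValue]
  exact (AddEquiv.ofBijective (extTop θ) (extTop_bijective θ)).symm_apply_apply _

/-- The left action multiplies the value on the top generator by `s` from the left, and the
augmentation is multiplicative. -/
theorem extEquiv_extLeftAct (s : STheta θ)
    (e : Ext (trivialRight (aug θ)) (rightRegular (STheta θ)) (n + 1)) :
    extEquiv θ (extLeftAct s e) = aug θ s * extEquiv θ e := by
  obtain ⟨f, hf, rfl⟩ := (koszulResolution θ).extMk_surjective e (n + 1 + 1) rfl
  rw [extLeftAct, ProjectiveResolution.extMk_comp_mk₀, extEquiv_extMk, extEquiv_extMk, ← map_mul]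
  rfl

/-- The Koszul resolutions of all modules bound the dimension above; Ext^{n+1}(k, S_θ) ≅ k ≠ 0
bounds it below. -/
theorem hasGlobalDimension_op : HasGlobalDimension (STheta θ)ᵐᵒᵖ (n + 1) :=
  hasGlobalDimension_of_resolutions (exists_resolution θ) (trivialRight (aug θ))
    (rightRegular (STheta θ)) (extEquiv θ).toEquiv.nontrivial

theorem hasGlobalDimension : HasGlobalDimension (STheta θ) (n + 1) :=
  (hasGlobalDimension_op θ.transpose).of_ringEquiv
    ((opEquiv θ.transpose).toRingEquiv : STheta θ ≃+* (STheta θ.transpose)ᵐᵒᵖ)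

end STheta

/-! ### Homogeneous components -/

section Component

variable {M N : Type*} [AddCommGroup M] [AddCommGroup N] {deg : ℤ → AddSubgroup M}
  {deg' : ℤ → AddSubgroup N}

/-- The homogeneous component of degree `p`. -/
noncomputable def homComponent (h : IsInternal deg) (p : ℤ) (y : M) : M :=
  letI := h.chooseDecomposition
  (decompose deg y p : M)

theorem homComponent_mem (h : IsInternal deg) (p : ℤ) (y : M) : homComponent h p y ∈ deg p :=
  SetLike.coe_mem _

theorem homComponent_of_mem (h : IsInternal deg) {p : ℤ} {y : M} (hy : y ∈ deg p) :
    homComponent h p y = y :=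
  letI := h.chooseDecomposition
  decompose_of_mem_same deg hy

theorem homComponent_of_mem_ne (h : IsInternal deg) {p q : ℤ} {y : M} (hy : y ∈ deg p)
    (hpq : p ≠ q) : homComponent h q y = 0 :=
  letI := h.chooseDecomposition
  decompose_of_mem_ne deg hy hpq

theorem homComponent_zero (h : IsInternal deg) (p : ℤ) : homComponent h p 0 = 0 :=
  homComponent_of_mem h (zero_mem _)

theorem homComponent_add (h : IsInternal deg) (p : ℤ) (y z : M) :
    homComponent h p (y + z) = homComponent h p y + homComponent h p z := by
  let _ := h.chooseDecomposition
  simp [homComponent, decompose_add]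

theorem homComponent_sum (h : IsInternal deg) (p : ℤ) {ι : Type*} (s : Finset ι) (y : ι → M) :
    homComponent h p (∑ i ∈ s, y i) = ∑ i ∈ s, homComponent h p (y i) :=
  map_sum (⟨⟨homComponent h p, homComponent_zero h p⟩, homComponent_add h p⟩ : M →+ M) y s

theorem homComponent_induction (h : IsInternal deg) {P : M → Prop} (zero : P 0)
    (mem : ∀ p, ∀ y ∈ deg p, P y) (add : ∀ y z, P y → P z → P (y + z)) (y : M) : P y := by
  let _ := h.chooseDecomposition
  exact Decomposition.inductionOn deg zero (fun m => mem _ _ m.2) add y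

/-- Homogeneous maps commute with taking homogeneous components. -/
theorem homComponent_apply (h : IsInternal deg) (h' : IsInternal deg') (g : M →+ N) (q : ℤ)
    (hg : ∀ p, ∀ y ∈ deg p, g y ∈ deg' (p + q)) (p : ℤ) (y : M) :
    homComponent h' (p + q) (g y) = g (homComponent h p y) := by
  induction y using homComponent_induction h with
  | zero => rw [map_zero, homComponent_zero, homComponent_zero, map_zero]
  | mem r y hy =>
    by_cases hr : r = p
    · subst hr
      rw [homComponent_of_mem h hy, homComponent_of_mem h' (hg _ y hy)]
    · rw [homComponent_of_mem_ne h hy hr, map_zero,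
        homComponent_of_mem_ne h' (hg r y hy) (by omega)]
  | add y z hy hz => rw [map_add, homComponent_add, homComponent_add, map_add, hy, hz]

theorem isInternal_of_components (pr : ℤ → M →+ M) (hmem : ∀ p y, pr p y ∈ deg p)
    (hpr : ∀ p q, ∀ y ∈ deg p, pr q y = if p = q then y else 0)
    (hsum : ∀ y, ∃ T : Finset ℤ, y = ∑ p ∈ T, pr p y) : IsInternal deg := by
  classical
  have key : ∀ (q : ℤ) (z : ⨁ p, deg p),
      pr q (DirectSum.coeAddMonoidHom deg z) = (z q : M) := by
    intro q z
    induction z using DirectSum.induction_on with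
    | zero => simp
    | of p y =>
      rw [DirectSum.coeAddMonoidHom_of, hpr p q y y.2]
      split_ifs with h
      · subst h
        rw [DirectSum.of_eq_same]
      · rw [DirectSum.of_eq_of_ne _ _ _ (Ne.symm h)]
        rfl
    | add y z hy hz => rw [map_add, map_add, hy, hz, DirectSum.add_apply]; rfl
  constructor
  · rw [injective_iff_map_eq_zero]
    intro z hz
    refine DFinsupp.ext fun q => Subtype.ext ?_
    rw [← key, hz, map_zero]
    rfl
  · intro y
    obtain ⟨T, hT⟩ := hsum y
    refine ⟨∑ p ∈ T, DirectSum.of (fun p => deg p) p ⟨pr p y, hmem p y⟩, ?_⟩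
    rw [map_sum]
    conv_rhs => rw [hT]
    exact Finset.sum_congr rfl fun p _ => DirectSum.coeAddMonoidHom_of _ _ _

end Component

namespace STheta

variable {k : Type u} [Field k] {n : ℕ} (a : Fin (n + 1) → ℕ)
  (θ : Matrix (Fin (n + 1)) (Fin (n + 1)) kˣ)

open KoszulType

/-! ### The grading of the Koszul resolution -/

/-- The degree of the generator `e_I`. -/
def genDegree (I : Finset (Fin (n + 1))) : ℤ := ∑ i ∈ I, (a i : ℤ)

theorem isRightGrading_koszul (m : ℕ) : IsRightGrading (grading a θ) (M := Koszul θ m)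
    (fun p => (koszulGrading a θ m p).toAddSubgroup) where
  isInternal := by
    refine isInternal_of_components
      (fun p => AddMonoidHom.pi fun I => (GradedRing.proj (grading a θ) (p - genDegree a I.1)).comp
        (Pi.evalAddMonoidHom _ I)) ?_ ?_ ?_
    · intro p f I _
      exact SetLike.coe_mem _
    · intro p q f hf
      funext I
      have h : f I ∈ grading a θ (p - genDegree a I.1) := hf I trivial
      change GradedRing.proj (grading a θ) (q - genDegree a I.1) (f I) = _
      rw [GradedRing.proj_apply]
      split_ifs with hpq
      · subst hpq
        exact decompose_of_mem_same _ h
      · exact decompose_of_mem_ne _ h (by omega)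
    · intro f
      classical
      -- All degrees that occur in some coordinate, each shifted by the degree of its generator.
      let T : Finset ℤ := Finset.univ.biUnion fun I : Subsets n m =>
        (DirectSum.decompose (grading a θ) (f I)).support.image (· + genDegree a I.1)
      refine ⟨T, funext fun I => ?_⟩
      rw [Finset.sum_apply]
      change f I = ∑ p ∈ T, (decompose (grading a θ) (f I) (p - genDegree a I.1) : STheta θ)
      conv_lhs => rw [← DirectSum.sum_support_decompose (grading a θ) (f I)]
      refine Eq.trans ?_ (Finset.sum_subset (s₁ := (DirectSum.decompose (grading a θ)
        (f I)).support.image (· + genDegree a I.1)) ?_ ?_)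
      · rw [Finset.sum_image (fun _ _ _ _ h => add_right_cancel h)]
        exact Finset.sum_congr rfl fun p _ => by rw [add_sub_cancel_right]
      · exact Finset.subset_biUnion_of_mem (fun I : Subsets n m =>
          (DirectSum.decompose (grading a θ) (f I)).support.image (· + genDegree a I.1))
          (Finset.mem_univ I)
      · intro p _ hp
        by_contra h
        apply hp
        rw [Finset.mem_image]
        refine ⟨p - genDegree a I.1, ?_, by ring⟩
        rw [DFinsupp.mem_support_toFun]
        exact fun h' => h (by rw [h']; rfl)
  smul_mem p q f s hf hs I _ := by
    have h : f I * s ∈ grading a θ (p - genDegree a I.1 + q) :=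
      SetLike.mul_mem_graded (hf I trivial) hs
    rwa [sub_add_eq_add_sub] at h

/-- The Koszul resolution as a graded projective resolution. -/
noncomputable def gradedKoszulResolution :
    GradedProjectiveResolution (grading a θ) (aug θ) where
  res := koszulResolution θ
  deg m p := ((koszulGrading a θ m p).toAddSubgroup : AddSubgroup (Koszul θ m))
  isRightGrading m := isRightGrading_koszul a θ m
  d_mem m p y hy := by
    rw [koszulResolution_d]
    exact koszulD_mem θ a m p y hy
  π_eq_zero p y hp hy := by
    rw [koszulResolution_π]
    exact (isKoszulResolution θ a).aug_eq_zero p y hp hy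

theorem koszulCoeff_mem (I : Finset (Fin (n + 1))) (i : Fin (n + 1)) :
    koszulCoeff θ I i ∈ grading a θ (a i) := Submodule.smul_mem _ _ (x_mem a θ i)

end STheta

namespace STheta

variable {k : Type u} [Field k] {n : ℕ} (a : Fin (n + 1) → ℕ)
  (θ : Matrix (Fin (n + 1)) (Fin (n + 1)) kˣ)

open KoszulType

/-! ### The part of degree `0` of a homomorphism out of the Koszul resolution -/

section DegreeZero

variable {Y Y' : Type u} [AddCommGroup Y] [Module (STheta θ)ᵐᵒᵖ Y] [AddCommGroup Y']
  [Module (STheta θ)ᵐᵒᵖ Y'] {deg : ℤ → AddSubgroup Y} {deg' : ℤ → AddSubgroup Y'}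

/-- The part of degree `0` of a homomorphism from a Koszul term to a graded module. -/
noncomputable def degreeZeroPart (h : IsInternal deg) {m : ℕ}
    (g : Koszul θ m →ₗ[(STheta θ)ᵐᵒᵖ] Y) : Koszul θ m →ₗ[(STheta θ)ᵐᵒᵖ] Y :=
  koszulLift θ fun I => homComponent h (genDegree a I.1) (g (Pi.single I 1))

theorem degreeZeroPart_single (h : IsInternal deg) {m : ℕ}
    (g : Koszul θ m →ₗ[(STheta θ)ᵐᵒᵖ] Y) (I : Subsets n m) :
    degreeZeroPart a θ h g (Pi.single I 1) =
      homComponent h (genDegree a I.1) (g (Pi.single I 1)) := by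
  rw [degreeZeroPart, koszulLift_single, MulOpposite.op_one, one_smul]

theorem genDegree_erase (I : Finset (Fin (n + 1))) {i : Fin (n + 1)} (hi : i ∈ I) :
    genDegree a (I.erase i) + a i = genDegree a I :=
  Finset.sum_erase_add I (fun i => (a i : ℤ)) hi

theorem homComponent_op_smul (h : IsRightGrading (grading a θ) deg) (p q : ℤ)
    {s : STheta θ} (hs : s ∈ grading a θ q) (y : Y) :
    homComponent h.isInternal (p + q) (MulOpposite.op s • y) =
      MulOpposite.op s • homComponent h.isInternal p y :=
  homComponent_apply h.isInternal h.isInternal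
    (DistribSMul.toAddMonoidHom Y (MulOpposite.op s)) q
    (fun p y hy => h.smul_mem p q y s hy hs) p y

/-- The coefficient of e_{I \ i} in the differential of e_I has degree a_i, the difference of the
degrees of the generators, and δ preserves degrees. So the relation `hg` may be projected to the
degree of e_I. -/
theorem comp_degreeZeroPart (h : IsRightGrading (grading a θ) deg)
    (h' : IsRightGrading (grading a θ) deg') (δ : Y' →ₗ[(STheta θ)ᵐᵒᵖ] Y)
    (hδ : ∀ p, ∀ y ∈ deg' p, δ y ∈ deg p) {m : ℕ} (g : Koszul θ m →ₗ[(STheta θ)ᵐᵒᵖ] Y)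
    (g' : Koszul θ (m + 1) →ₗ[(STheta θ)ᵐᵒᵖ] Y') (hg : δ ∘ₗ g' = g ∘ₗ koszulD θ m) :
    δ ∘ₗ degreeZeroPart a θ h'.isInternal g' =
      degreeZeroPart a θ h.isInternal g ∘ₗ koszulD θ m := by
  refine koszul_hom_ext θ fun I => ?_
  have h₁ := homComponent_apply h'.isInternal h.isInternal δ.toAddMonoidHom 0
    (fun p y hy => by rw [add_zero]; exact hδ p y hy) (genDegree a I.1) (g' (Pi.single I 1))
  have h₂ : δ (g' (Pi.single I 1)) = g (koszulD θ m (Pi.single I 1)) := LinearMap.congr_fun hg _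
  rw [LinearMap.comp_apply, LinearMap.comp_apply, degreeZeroPart_single, apply_koszulD_single]
  refine h₁.symm.trans ?_
  change homComponent h.isInternal _ (δ _) = _
  rw [h₂, apply_koszulD_single, homComponent_sum, add_zero]
  refine Finset.sum_congr rfl fun i _ => ?_
  rw [degreeZeroPart_single, ← genDegree_erase a I.1 i.2,
    homComponent_op_smul a θ h _ _ (koszulCoeff_mem a θ I.1 i.1)]
  rfl

end DegreeZero

theorem apply_homComponent_zero {M N : Type*} [AddCommGroup M] [AddCommGroup N]
    {deg : ℤ → AddSubgroup M} (h : IsInternal deg) (g : M →+ N)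
    (hg : ∀ p, p ≠ 0 → ∀ y ∈ deg p, g y = 0) (y : M) : g (homComponent h 0 y) = g y := by
  induction y using homComponent_induction h with
  | zero => rw [homComponent_zero]
  | mem p y hy =>
    by_cases hp : p = 0
    · subst hp
      rw [homComponent_of_mem h hy]
    · rw [homComponent_of_mem_ne h hy hp, hg p hp y hy, map_zero]
  | add y z hy hz => rw [homComponent_add, map_add, map_add, hy, hz]

variable {a θ}

/-- The linear maps underlying a lift of the identity to a map from the Koszul resolution. -/
noncomputable def liftMap (P : ProjectiveResolution (trivialRight (aug θ))) (m : ℕ) :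
    Koszul θ m →ₗ[(STheta θ)ᵐᵒᵖ] P.complex.X m :=
  ((ProjectiveResolution.lift (𝟙 _) (koszulResolution θ) P).f m).hom

theorem liftMap_comm (P : ProjectiveResolution (trivialRight (aug θ))) (m : ℕ) :
    (P.complex.d (m + 1) m).hom ∘ₗ liftMap P (m + 1) = liftMap P m ∘ₗ koszulD θ m := by
  have h := (ProjectiveResolution.lift (𝟙 _) (koszulResolution θ) P).comm (m + 1) m
  rw [koszulResolution_d] at h
  exact congrArg ModuleCat.Hom.hom h

/-- A homogeneous map of degree `0` from the Koszul resolution to a graded projective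
resolution. -/
noncomputable def gradedLift (P : GradedProjectiveResolution (grading a θ) (aug θ)) (m : ℕ) :
    Koszul θ m →ₗ[(STheta θ)ᵐᵒᵖ] P.res.complex.X m :=
  degreeZeroPart a θ (P.isRightGrading m).isInternal (liftMap P.res m)

theorem gradedLift_comm (P : GradedProjectiveResolution (grading a θ) (aug θ)) (m : ℕ) :
    (P.res.complex.d (m + 1) m).hom ∘ₗ gradedLift P (m + 1) =
      gradedLift P m ∘ₗ koszulD θ m :=
  comp_degreeZeroPart a θ (P.isRightGrading m) (P.isRightGrading (m + 1)) _ (P.d_mem m) _ _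
    (liftMap_comm P.res m)

/-- The generator e_∅ has degree 0 and the augmentation kills all other degrees, so passing to the
part of degree 0 does not change the composite. -/
theorem π_gradedLift (P : GradedProjectiveResolution (grading a θ) (aug θ)) :
    (P.res.π.f 0).hom ∘ₗ gradedLift P 0 = koszulAug θ := by
  refine koszul_hom_ext θ fun I => ?_
  have h := (ProjectiveResolution.lift_commutes_zero (𝟙 _) (koszulResolution θ) P.res).trans
    (Category.comp_id _)
  rw [koszulResolution_π] at h
  have h' := LinearMap.congr_fun (congrArg ModuleCat.Hom.hom h) (Pi.single I 1 : Koszul θ 0)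
  refine Eq.trans ?_ h'
  rw [LinearMap.comp_apply, gradedLift, degreeZeroPart_single, Finset.card_eq_zero.1 I.2]
  exact apply_homComponent_zero _ (P.res.π.f 0).hom.toAddMonoidHom
    (fun p hp y hy => P.π_eq_zero p y hp hy) _

/-- The morphism of resolutions given by `gradedLift`. -/
noncomputable def gradedLiftHom (P : GradedProjectiveResolution (grading a θ) (aug θ)) :
    ProjectiveResolution.Hom (koszulResolution θ) P.res (𝟙 _) where
  hom :=
    { f := fun m => (ModuleCat.ofHom (gradedLift P m) :)
      comm' := by
        rintro _ m rfl
        rw [koszulResolution_d]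
        exact ModuleCat.hom_ext (gradedLift_comm P m) }
  hom_f_zero_comp_π_f_zero := by
    rw [koszulResolution_π, CategoryTheory.Functor.map_id]
    exact ModuleCat.hom_ext (π_gradedLift P)

theorem isHomogeneousExt_iff (j : ℤ)
    (e : Ext (trivialRight (aug θ)) (rightRegular (STheta θ)) (n + 1)) :
    IsHomogeneousExt (grading a θ) (aug θ) e j ↔
      (j + ∑ i, (a i : ℤ) = 0 ∨ extEquiv θ e = 0) := by
  constructor
  · rintro ⟨P, f, hf, hdeg, rfl⟩
    -- Composing with the class of the identity, represented by the graded comparison map,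
    -- transports the cocycle to the Koszul resolution without changing its class.
    rw [← Ext.mk₀_id_comp (P.res.extMk f (n + 1 + 1) rfl hf),
      ProjectiveResolution.mk₀_comp_extMk f _ rfl hf (gradedLiftHom P), extEquiv_extMk,
      or_iff_not_imp_left]
    intro hj
    have hmem : gradedLift P (n + 1) (Pi.single (topSubset n) 1) ∈
        P.deg (n + 1) (∑ i, (a i : ℤ)) := by
      rw [gradedLift, degreeZeroPart_single]
      exact homComponent_mem _ _ _
    exact aug_eq_zero θ a (fun h => hj ((add_comm _ _).trans h)) (hdeg _ _ hmem)
  · intro h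
    by_cases he : extEquiv θ e = 0
    · rw [(extEquiv θ).map_eq_zero_iff] at he
      subst he
      refine ⟨gradedKoszulResolution a θ, 0, by simp, fun p y _ => zero_mem _, ?_⟩
      exact ProjectiveResolution.extMk_zero _ _ _
    · have hj := h.resolve_right he
      -- The cocycle sending the top generator, of degree l, to a scalar is homogeneous of degree -l
      -- = j.
      refine ⟨gradedKoszulResolution a θ, homOfLinearMap θ
        (koszulLift θ fun _ : Subsets n (n + 1) => algebraMap k _ (extEquiv θ e)),
        d_comp_top θ _, ?_, (extEquiv θ).symm_apply_apply e⟩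
      intro p v hv
      change ∑ I, algebraMap k (STheta θ) (extEquiv θ e) * (v : Koszul θ (n + 1)) I ∈
        grading a θ (p + j)
      refine Submodule.sum_mem _ fun I _ => ?_
      have hI : (v : Koszul θ (n + 1)) I ∈ grading a θ (p - genDegree a I.1) := hv I trivial
      rw [eq_topSubset I] at hI ⊢
      have hp : p + j = p - genDegree a (topSubset n).1 := by
        change p + j = p - ∑ i, (a i : ℤ)
        omega
      rw [hp, ← Algebra.smul_def]
      exact Submodule.smul_mem _ _ hI

end STheta

theorem mainTheorem12 {k : Type u} [Field k] (n : ℕ) (a : Fin (n + 1) → ℕ)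
    (ha : ∀ i, 0 < a i) (θ : Matrix (Fin (n + 1)) (Fin (n + 1)) kˣ) :
    IsNoetherianRing (STheta θ) ∧ IsNoetherianRing (STheta θ)ᵐᵒᵖ ∧
      IsASRegular (STheta.grading a θ) (STheta.aug θ) (n + 1) (∑ i, (a i : ℤ)) ∧
      STheta.IsKoszulResolution a θ :=
  ⟨STheta.isNoetherianRing θ, STheta.isNoetherianRing_op θ,
    { connected := STheta.isConnectedGraded θ a ha
      right_globalDimension := STheta.hasGlobalDimension_op θ
      left_globalDimension := STheta.hasGlobalDimension θ
      polynomial_growth := STheta.polynomial_growth θ a ha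
      gorenstein :=
        { ext_eq_zero := fun _ hi => subsingleton_of_forall_eq 0 (STheta.ext_eq_zero θ hi)
          ext_equiv := ⟨STheta.extEquiv θ, STheta.extEquiv_extLeftAct θ,
            STheta.isHomogeneousExt_iff⟩ } },
    STheta.isKoszulResolution θ a⟩
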